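/- Let $\mathcal A$ be a finite alphabet and let $X\subset\mathcal A^{\mathbb Z^2}$ be a $\mathbb Z^2$-subshift, i.e. a closed set invariant under all translations $(T^ux)(v)=x(u+v)$. For $S,T\subset\mathbb R^2$, say that $S$ *$X$-codes* $T$ if any two elements of $X$ that agree on $S\cap\mathbb Z^2$ agree on $T\cap\mathbb Z^2$. A *convex integer polygon* is the convex hull of finitely many (at least two) points of $\mathbb Z^2$; a line segment is allowed, as a degenerate polygon with two vertices and two sides, namely the segment in its two orientations. Edges are oriented counterclockwise, so that the polygon lies to the left of each oriented edge. A convex integer polygon $P$ is a *coding polygon* for $X$ if $P\setminus\{v\}$ $X$-codes $\{v\}$ for every vertex $v$ of $P$. An infinite subshift that has a coding polygon is called *polygonal*. A $\mathbb Z^2$-subshift $Y$ over a finite alphabet is a *recoding* of $X$ if there are a finite set $F\subset\mathbb Z^2$ and a homeomorphism $\Psi:X\to Y$ commuting with all translations such that, for all $u\in\mathbb Z^2$ and $x,x'\in X$, $\Psi(x)(u)=\Psi(x')(u)$ if and only if $x$ and $x'$ agree on $u+F$. A *ray* is a translate of $\{tv:t\ge 0\}$ with $v\in\mathbb R^2$,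 $v\neq0$, oriented by increasing $t$; two rays are positively parallel if one is a translate of the other, and an oriented segment is positively parallel to a ray if it has the same direction. A ray is *expansive* for $X$ if an open or closed half plane whose boundary is parallel to the ray, and which lies to the left of its boundary when that is given the direction of the ray, $X$-codes $\mathbb R^2$ (this does not depend on the choice of the half plane); otherwise it is *nonexpansive*. A ray with direction $v$ is *closing* for $X$ if the line $L=\mathbb Rv$ has rational slope (possibly infinite), the closed half plane $H$ bounded by $L$ and lying to the left of $v$ does not $X$-code $\mathbb R^2$, and, with $L_0$ the line closest to $H$ among the lines $z+L$, $z\in\mathbb Z^2$, in the complement of $H$, there is $N>0$ such that for every set $B$ of at least $N$ points that is the intersection of $\mathbb Z^2$ with a segment of $L_0$, the set $H\cup B$ $X$-codes $H\cup L_0$. **Theorem.** Let $X$ be an infinite polygonal $\mathbb Z^2$-subshift, and let $P$ be a coding polygon for some recoding of $X$ which has the minimal number of sides among all coding polygons for recodings of $X$. Then every ray positively parallel to an oriented edge of $P$ is closing for $X$, and a ray is nonexpansive for $X$ if and only if it is positively parallel to an oriented edge of $P$. -/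

import Mathlib

open SymbolicDynamics.FullShift

universe u

noncomputable section

/-- The inclusion of the integer lattice into the plane. -/
def latticePt (z : ℤ × ℤ) : ℝ × ℝ := ((z.1 : ℝ), (z.2 : ℝ))

/-- The determinant `det (v, w)`. It is nonnegative when `w` lies in the closed half plane to the
left of the line through `0` directed by `v`; for nonzero `v` the quantity `|cross v w|`, divided
by the Euclidean norm of `v`, is the distance from `w` to that line. -/
def cross (v w : ℝ × ℝ) : ℝ := v.1 * w.2 - v.2 * w.1

/-- `S` codes `T` for the shift `X`: two colorings in `X` that agree at the lattice points of `S`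
also agree at the lattice points of `T`. -/
def Codes {A : Type*} [TopologicalSpace A] (X : Subshift A (ℤ × ℤ)) (S T : Set (ℝ × ℝ)) : Prop :=
  ∀ x ∈ X.carrier, ∀ y ∈ X.carrier,
    (∀ z : ℤ × ℤ, latticePt z ∈ S → x z = y z) → ∀ z : ℤ × ℤ, latticePt z ∈ T → x z = y z

/-- The shift `Y` is a recoding of `X` via the finite set `F`: there is an isomorphism of shifts
`Ψ` from `X` to `Y` such that the color of `Ψ x` at `z` determines, and is determined by,
the restriction of `x` to the translate `z + F`. -/
def IsRecodingVia {A B : Type*} [TopologicalSpace A] [TopologicalSpace B]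
    (X : Subshift A (ℤ × ℤ)) (F : Finset (ℤ × ℤ)) (Y : Subshift B (ℤ × ℤ)) : Prop :=
  ∃ Ψ : X.carrier ≃ₜ Y.carrier,
    (∀ (g : ℤ × ℤ) (x : X.carrier),
      (Ψ ⟨shift g x.1, X.mapsTo g x.2⟩ : ℤ × ℤ → B) = shift g (Ψ x).1) ∧
    ∀ (z : ℤ × ℤ) (x x' : X.carrier),
      (Ψ x).1 z = (Ψ x').1 z ↔ ∀ f ∈ F, x.1 (z + f) = x'.1 (z + f)

/-- `Y` is a recoding of `X` via some finite set. -/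
def IsRecoding {A B : Type*} [TopologicalSpace A] [TopologicalSpace B]
    (X : Subshift A (ℤ × ℤ)) (Y : Subshift B (ℤ × ℤ)) : Prop :=
  ∃ F : Finset (ℤ × ℤ), IsRecodingVia X F Y

/-- A convex integer polygon: the convex hull of a finite set of at least two lattice points.
A segment is allowed; it is the degenerate polygon with two vertices. -/
def IsConvexIntegerPolygon (P : Set (ℝ × ℝ)) : Prop :=
  ∃ V : Finset (ℤ × ℤ), V.Nontrivial ∧ P = convexHull ℝ (latticePt '' (V : Set (ℤ × ℤ)))

/-- The vertices of a convex polygon are its extreme points. -/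
def polygonVertices (P : Set (ℝ × ℝ)) : Set (ℝ × ℝ) := P.extremePoints ℝ

/-- The oriented edges of a convex polygon, as pairs (initial vertex, terminal vertex): the polygon
lies to the left of each edge, that is, the boundary is traversed counterclockwise.
A segment with endpoints `a`, `b` has the two oriented edges `(a, b)` and `(b, a)`. -/
def orientedEdges (P : Set (ℝ × ℝ)) : Set ((ℝ × ℝ) × (ℝ × ℝ)) :=
  {e | e.1 ∈ polygonVertices P ∧ e.2 ∈ polygonVertices P ∧ e.1 ≠ e.2 ∧
    ∀ p ∈ P, 0 ≤ cross (e.2 - e.1) (p - e.1)}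

/-- The number of sides of a convex polygon (a segment has two). -/
def numSides (P : Set (ℝ × ℝ)) : ℕ∞ := (orientedEdges P).encard

/-- `P` is a coding polygon for `X`: it is a convex integer polygon, and for each vertex `v` of `P`
the coloring of the other lattice points of `P` determines the color of `v`. -/
def IsCodingPolygon {A : Type*} [TopologicalSpace A] (X : Subshift A (ℤ × ℤ))
    (P : Set (ℝ × ℝ)) : Prop :=
  IsConvexIntegerPolygon P ∧ ∀ v ∈ polygonVertices P, Codes X (P \ {v}) {v}

/-- `X` is polygonal. -/
def IsPolygonal {A : Type*} [TopologicalSpace A] (X : Subshift A (ℤ × ℤ)) : Prop :=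
  X.carrier.Infinite ∧ ∃ P, IsCodingPolygon X P

/-- `P` is a coding polygon for some recoding of `X`. The alphabets of recodings are arbitrary
finite discrete spaces in the universe of the alphabet of `X`. -/
def IsRecodingPolygon {A : Type u} [TopologicalSpace A] (X : Subshift A (ℤ × ℤ))
    (P : Set (ℝ × ℝ)) : Prop :=
  ∃ (B : Type u) (_ : Finite B) (_ : TopologicalSpace B) (_ : DiscreteTopology B)
    (Y : Subshift B (ℤ × ℤ)), IsRecoding X Y ∧ IsCodingPolygon Y P

/-- The closed half planes whose boundary, with the orientation induced by the half plane, has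
direction `v` (the half plane lies to the left of its boundary). -/
def closedHalfPlane (v : ℝ × ℝ) (c : ℝ) : Set (ℝ × ℝ) := {p | c ≤ cross v p}

/-- The open half planes whose boundary, with the induced orientation, has direction `v`. -/
def openHalfPlane (v : ℝ × ℝ) (c : ℝ) : Set (ℝ × ℝ) := {p | c < cross v p}

/-- A ray with direction `v ≠ 0` (such as `{t • v | t ≥ 0}` or a translate of it) is expansive if
some (open or closed) half plane whose oriented boundary has the direction of the ray
codes the whole plane. -/
def IsExpansiveRay {A : Type*} [TopologicalSpace A] (X : Subshift A (ℤ × ℤ)) (v : ℝ × ℝ) : Prop :=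
  ∃ c : ℝ, Codes X (closedHalfPlane v c) Set.univ ∨ Codes X (openHalfPlane v c) Set.univ

/-- A ray is nonexpansive if it is not expansive. -/
def IsNonexpansiveRay {A : Type*} [TopologicalSpace A] (X : Subshift A (ℤ × ℤ))
    (v : ℝ × ℝ) : Prop :=
  ¬ IsExpansiveRay X v

/-- The line parallel to `v` through the point `q`. -/
def lineThrough (v q : ℝ × ℝ) : Set (ℝ × ℝ) := {p | cross v p = cross v q}

/-- For the closed half plane `H = {p | 0 ≤ cross v p}`, the translate of the boundary line of `H`
by the lattice point `z` lies in the complement of `H` and is the closest to `H` among the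
translates by lattice points that lie in this complement. -/
def IsClosestOutside (v : ℝ × ℝ) (z : ℤ × ℤ) : Prop :=
  cross v (latticePt z) < 0 ∧
    ∀ z' : ℤ × ℤ, cross v (latticePt z') < 0 → cross v (latticePt z') ≤ cross v (latticePt z)

/-- The ray `{t • v | t ≥ 0}` is closing for `X`. Here `L` is the line it spans, which has to be
nonzero and rational, and `H` is the closed half plane bounded by `L` and lying to the left of `v`,
which has to be nonexpansive. With `L₀` the closest lattice translate of `L` outside `H`, there is
`N > 0` such that every block in `L₀` (the set of lattice points of a segment of `L₀`) with at least
`N` elements codes, together with `H`, all of `H ∪ L₀`. -/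
def IsClosingRay {A : Type*} [TopologicalSpace A] (X : Subshift A (ℤ × ℤ)) (v : ℝ × ℝ) : Prop :=
  v ≠ 0 ∧ (∃ w : ℤ × ℤ, w ≠ 0 ∧ cross v (latticePt w) = 0) ∧
  ¬ Codes X (closedHalfPlane v 0) Set.univ ∧
  ∃ z : ℤ × ℤ, IsClosestOutside v z ∧
    ∃ N : ℕ, 0 < N ∧
      ∀ a ∈ lineThrough v (latticePt z), ∀ b ∈ lineThrough v (latticePt z),
        (N : ℕ∞) ≤ {y : ℤ × ℤ | latticePt y ∈ segment ℝ a b}.encard →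
          Codes X (closedHalfPlane v 0 ∪ segment ℝ a b)
            (closedHalfPlane v 0 ∪ lineThrough v (latticePt z))

end

/-! A direction that is not an edge direction of `P` has a unique lowest vertex on `P`. Translates
of `P` with that vertex just outside a half plane recover its color, so the half plane grows in
strips of fixed width until it covers the plane: the direction is expansive
(`IsCodingPolygon.isExpansiveRay`). Expansiveness passes between a shift and its recodings.

It remains to see that edge directions are nonexpansive. Let an edge of lattice length `L` and
primitive direction `d` be expansive for the recoding `Y` coded by `P`; call `latticeCross d z` the
level of `z`. If everything above a row is known, `L` consecutive colors in the row propagate along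
it, by sliding `P` (`EdgeCoding.row_subset`). By compactness a finite set of positive level codes
`0`, so the rows above provide such a block wherever there is room. Hence in a wedge whose sides are
parallel to the two adjacent edges, a slab of fixed height codes the next row down as long as the
row is wide enough (`EdgeCoding.exists_wedge_row`).

With `u`, `w` the adjacent edge vectors, the sign of `latticeCross w u` decides how row widths
change on the way down. If the rows widen, a finite slab codes translates of all finite sets and the
shift is finite, a contradiction. If the width is constant, a finite set `G` and `u + G` code each
other, so a segment codes the recoding by patterns on `G`. If the rows narrow, the apex region is
coded by its translates up the two sides; a multiple of `P`, extended to the point where the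
adjacent sides meet, then codes a recoding and has one vertex fewer. A degenerate `P` also forces
finiteness. Each case contradicts infinitude or minimality (`IsCodingPolygon.exists_fewer_sides`).

Closing comes from the same propagation: a half plane together with a long block in the next row
codes that row, and this transfers from `Y` to `X` at the cost of a longer block
(`IsRecodingVia.exists_closing_block`). -/

/-- The lattice points whose color is determined by the colors on `S`. -/
def determined {A : Type*} [TopologicalSpace A] (X : Subshift A (ℤ × ℤ)) (S : Set (ℤ × ℤ)) :
    Set (ℤ × ℤ) :=
  {z | ∀ x ∈ X.carrier, ∀ y ∈ X.carrier, (∀ s ∈ S, x s = y s) → x z = y z}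

/-! ### Coding as a closure operator on sets of lattice points -/

section Determined

variable {A : Type*} [TopologicalSpace A] {X : Subshift A (ℤ × ℤ)}

theorem codes_iff {S T : Set (ℝ × ℝ)} :
    Codes X S T ↔ latticePt ⁻¹' T ⊆ determined X (latticePt ⁻¹' S) :=
  ⟨fun h z hz x hx y hy hxy => h x hx y hy hxy z hz,
    fun h x hx y hy hxy _ hz => h hz x hx y hy hxy⟩

theorem subset_determined (S : Set (ℤ × ℤ)) : S ⊆ determined X S :=
  fun _ hz _ _ _ _ h => h _ hz

theorem determined_subset {S T : Set (ℤ × ℤ)} (h : S ⊆ determined X T) :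
    determined X S ⊆ determined X T :=
  fun _ hz x hx y hy hxy => hz x hx y hy fun _ hs => h hs x hx y hy hxy

theorem determined_mono {S T : Set (ℤ × ℤ)} (h : S ⊆ T) : determined X S ⊆ determined X T :=
  determined_subset (h.trans (subset_determined T))

theorem add_mem_determined {S T : Set (ℤ × ℤ)} {z : ℤ × ℤ} (g : ℤ × ℤ) (hz : z ∈ determined X S)
    (h : ∀ s ∈ S, g + s ∈ determined X T) : g + z ∈ determined X T :=
  fun x hx y hy hxy => hz _ (X.mapsTo g hx) _ (X.mapsTo g hy) fun s hs => h s hs x hx y hy hxy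

/-- Compactness: the pairs in `X` that differ at `z` form a compact set, and the closed conditions
of agreement at the points of `S` have empty intersection on it, so finitely many of them already
do. -/
theorem exists_finite_of_mem_determined [Finite A] [DiscreteTopology A] {S : Set (ℤ × ℤ)}
    {z : ℤ × ℤ} (hz : z ∈ determined X S) :
    ∃ K : Finset (ℤ × ℤ), (K : Set (ℤ × ℤ)) ⊆ S ∧ z ∈ determined X K := by
  classical
  have hcomp : IsCompact (X.carrier ×ˢ X.carrier ∩ {p | p.1 z ≠ p.2 z}) := by
    refine (X.isClosed.isCompact.prod X.isClosed.isCompact).inter_right ?_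
    have : Continuous fun p : (ℤ × ℤ → A) × (ℤ × ℤ → A) => (p.1 z, p.2 z) := by fun_prop
    exact (isClosed_discrete {q : A × A | q.1 ≠ q.2}).preimage this
  obtain ⟨K, hK⟩ := hcomp.elim_finite_subfamily_closed
    (fun s : S => {p : (ℤ × ℤ → A) × (ℤ × ℤ → A) | p.1 s = p.2 s})
    (fun s => isClosed_eq (by fun_prop) (by fun_prop)) (by
      rw [Set.eq_empty_iff_forall_notMem]
      rintro ⟨x, y⟩ ⟨⟨⟨hx, hy⟩, hne⟩, h⟩
      exact hne (hz x hx y hy fun s hs => Set.mem_iInter.1 h ⟨s, hs⟩))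
  refine ⟨K.image Subtype.val, by simp, fun x hx y hy hxy => ?_⟩
  by_contra hne
  have hmem : (x, y) ∈ (X.carrier ×ˢ X.carrier ∩ {p | p.1 z ≠ p.2 z}) ∩
      ⋂ s ∈ K, {p : (ℤ × ℤ → A) × (ℤ × ℤ → A) | p.1 s = p.2 s} := by
    refine ⟨⟨⟨hx, hy⟩, hne⟩, Set.mem_iInter₂.2 fun s hs => ?_⟩
    exact hxy s (Finset.mem_coe.2 (Finset.mem_image_of_mem _ hs))
  rw [hK] at hmem
  exact hmem

/-- If a finite set determines translates of all finite sets, then the shift is finite. -/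
theorem finite_of_determined [Finite A] {G : Set (ℤ × ℤ)} (hG : G.Finite)
    (h : ∀ D : Finset (ℤ × ℤ), ∃ g : ℤ × ℤ, ∀ z ∈ D, g + z ∈ determined X G) :
    X.carrier.Finite := by
  classical
  -- Pigeonhole: take more points of `X` than there are patterns on `G`. Finitely many sites `w`
  -- separate them; after a shift moving these sites into the region coded by `G`, two of the points
  -- agree on `G`, hence at the site separating them.
  by_contra hinf
  have : Finite G := hG
  have := Fintype.ofFinite (G → A)
  obtain ⟨T, hTX, hT⟩ := Set.Infinite.exists_subset_card_eq hinf (Fintype.card (G → A) + 1)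
  have hsep : ∀ p : (ℤ × ℤ → A) × (ℤ × ℤ → A), ∃ z, p.1 ≠ p.2 → p.1 z ≠ p.2 z := by
    intro p
    by_cases hp : p.1 = p.2
    · exact ⟨0, fun h => (h hp).elim⟩
    · obtain ⟨z, hz⟩ := Function.ne_iff.1 hp
      exact ⟨z, fun _ => hz⟩
  choose w hw using hsep
  obtain ⟨g, hg⟩ := h ((T ×ˢ T).image w)
  obtain ⟨x, hx, y, hy, hne, heq⟩ := Finset.exists_ne_map_eq_of_card_lt_of_maps_to
    (s := T) (t := Finset.univ) (f := fun x (s : G) => shift (-g) x s)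
    (by rw [hT, Finset.card_univ]; exact Nat.lt_succ_self _) (by simp)
  refine hw (x, y) hne ?_
  have := hg (w (x, y)) (Finset.mem_image_of_mem _ (Finset.mk_mem_product hx hy))
    _ (X.mapsTo (-g) (hTX hx)) _ (X.mapsTo (-g) (hTX hy)) fun s hs => congrFun heq ⟨s, hs⟩
  simpa using this

/-- If a finite set determines its translate by `g`, then the translate determines the set. -/
theorem subset_determined_add [Finite A] {G : Set (ℤ × ℤ)} (hG : G.Finite) (g : ℤ × ℤ)
    (h : ∀ z ∈ G, g + z ∈ determined X G) : G ⊆ determined X ((g + ·) '' G) := by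
  have : Finite G := hG
  let R : Set (G → A) := Set.range fun (x : X.carrier) (s : G) => x.1 s
  -- The shift by `g` induces a self-map of the finite set of patterns of `X` on `G`. It is onto by
  -- shift invariance, hence injective, which is the claim.
  let φ : R → R := fun r =>
    ⟨fun s => shift g r.2.choose.1 s, ⟨⟨_, X.mapsTo g r.2.choose.2⟩, rfl⟩⟩
  have hφ : ∀ x : X.carrier, (φ ⟨_, x, rfl⟩).1 = fun s : G => shift g x.1 s := by
    intro x
    funext s
    have hx := (⟨_, x, rfl⟩ : R).2.choose_spec
    exact h s s.2 _ (Subtype.property _) _ x.2 fun t ht => congrFun hx ⟨t, ht⟩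
  have hsurj : Function.Surjective φ := by
    rintro ⟨_, x, rfl⟩
    refine ⟨⟨_, ⟨shift (-g) x.1, X.mapsTo _ x.2⟩, rfl⟩, Subtype.ext ?_⟩
    rw [hφ]
    funext s
    simp
  have hinj := Finite.injective_iff_surjective.2 hsurj
  intro z hz x hx y hy hxy
  have := @hinj ⟨_, ⟨x, hx⟩, rfl⟩ ⟨_, ⟨y, hy⟩, rfl⟩ (Subtype.ext (by
    rw [hφ, hφ]
    funext s
    exact hxy _ ⟨s, s.2, rfl⟩))
  exact congrFun (congrArg Subtype.val this) ⟨z, hz⟩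

end Determined

/-! ### Recodings and how they transport coding -/

section Recoding

open scoped Pointwise

/-- The dictionary for all transfers between `X` and `Y`: knowing `Y` on `S` is the same as knowing
`X` on `S + F`. -/
theorem IsRecodingVia.mem_determined_iff {A B : Type*} [TopologicalSpace A] [TopologicalSpace B]
    {X : Subshift A (ℤ × ℤ)} {F : Finset (ℤ × ℤ)} {Y : Subshift B (ℤ × ℤ)}
    (h : IsRecodingVia X F Y) {S : Set (ℤ × ℤ)} {z : ℤ × ℤ} :
    z ∈ determined Y S ↔ ∀ f ∈ F, z + f ∈ determined X (S + (F : Set (ℤ × ℤ))) := by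
  obtain ⟨Ψ, -, hΨ⟩ := h
  constructor
  · intro hz f hf x hx y hy hxy
    exact (hΨ z ⟨x, hx⟩ ⟨y, hy⟩).1 (hz _ (Subtype.property _) _ (Subtype.property _) fun s hs =>
      (hΨ s ⟨x, hx⟩ ⟨y, hy⟩).2 fun f hf => hxy _ (Set.add_mem_add hs hf)) f hf
  · intro hz x hx y hy hxy
    obtain ⟨x', rfl⟩ : ∃ x', (Ψ x').1 = x := ⟨Ψ.symm ⟨x, hx⟩, by simp⟩
    obtain ⟨y', rfl⟩ : ∃ y', (Ψ y').1 = y := ⟨Ψ.symm ⟨y, hy⟩, by simp⟩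
    refine (hΨ z x' y').2 fun f hf => hz f hf _ x'.2 _ y'.2 ?_
    rintro _ ⟨s, hs, f, hf, rfl⟩
    exact (hΨ s x' y').1 (hxy s hs) f hf

theorem IsRecodingVia.infinite {A B : Type*} [TopologicalSpace A] [TopologicalSpace B]
    {X : Subshift A (ℤ × ℤ)} {F : Finset (ℤ × ℤ)} {Y : Subshift B (ℤ × ℤ)}
    (h : IsRecodingVia X F Y) (hX : X.carrier.Infinite) : Y.carrier.Infinite := by
  obtain ⟨Ψ, -⟩ := h
  have := hX.to_subtype
  exact Set.infinite_coe_iff.1 (Infinite.of_injective Ψ Ψ.injective)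

theorem IsRecodingVia.nonempty {A B : Type*} [TopologicalSpace A] [TopologicalSpace B]
    {X : Subshift A (ℤ × ℤ)} {F : Finset (ℤ × ℤ)} {Y : Subshift B (ℤ × ℤ)}
    (h : IsRecodingVia X F Y) (hX : X.carrier.Infinite) : F.Nonempty := by
  by_contra hF
  rw [Finset.not_nonempty_iff_eq_empty] at hF
  subst hF
  obtain ⟨Ψ, -, hΨ⟩ := h
  have := hX.to_subtype
  obtain ⟨x, y, hne⟩ := exists_pair_ne X.carrier
  exact hne (Ψ.injective (Subtype.ext (funext fun z => (hΨ z x y).2 (by simp))))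

theorem IsRecodingVia.trans {A B C : Type*} [TopologicalSpace A] [TopologicalSpace B]
    [TopologicalSpace C] {X : Subshift A (ℤ × ℤ)} {F G : Finset (ℤ × ℤ)} {Y : Subshift B (ℤ × ℤ)}
    {Z : Subshift C (ℤ × ℤ)} (h : IsRecodingVia X F Y) (h' : IsRecodingVia Y G Z) :
    IsRecoding X Z := by
  classical
  obtain ⟨Ψ, hΨs, hΨ⟩ := h
  obtain ⟨Φ, hΦs, hΦ⟩ := h'
  refine ⟨G + F, Ψ.trans Φ, fun g x => ?_, fun z x x' => ?_⟩
  · simp only [Homeomorph.trans_apply]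
    rw [← hΦs]
    exact congrArg (fun y => (Φ y).1) (Subtype.ext (hΨs g x))
  · simp only [Homeomorph.trans_apply, hΦ, hΨ]
    constructor
    · intro h f hf
      obtain ⟨g, hg, f', hf', rfl⟩ := Finset.mem_add.1 hf
      rw [← add_assoc]
      exact h g hg f' hf'
    · intro h g hg f hf
      rw [add_assoc]
      exact h _ (Finset.add_mem_add hg hf)

/-- The recoding of a shift whose colors are the patterns on the translates of `G`. -/
theorem exists_isRecodingVia {A : Type u} [Finite A] [TopologicalSpace A] [DiscreteTopology A]
    (X : Subshift A (ℤ × ℤ)) (G : Finset (ℤ × ℤ)) (hG : G.Nonempty) :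
    ∃ Y : Subshift (G → A) (ℤ × ℤ), IsRecodingVia X G Y := by
  let φ : (ℤ × ℤ → A) → (ℤ × ℤ → G → A) := fun x z g => x (z + g)
  have hφ : Continuous φ := by fun_prop
  have hφs : ∀ g x, φ (shift g x) = shift g (φ x) := fun g x => by
    funext z f
    simp [φ, add_assoc]
  have hφi : Function.Injective φ := by
    intro x y hxy
    obtain ⟨g, hg⟩ := hG
    funext z
    simpa [φ] using congrFun (congrFun hxy (z - g)) ⟨g, hg⟩
  let Y : Subshift (G → A) (ℤ × ℤ) :=
    { carrier := φ '' X.carrier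
      isClosed := (X.isClosed.isCompact.image hφ).isClosed
      mapsTo := by
        rintro g _ ⟨x, hx, rfl⟩
        exact ⟨shift g x, X.mapsTo g hx, hφs g x⟩ }
  have : CompactSpace X.carrier := isCompact_iff_compactSpace.1 X.isClosed.isCompact
  let Ψ : X.carrier ≃ₜ Y.carrier := Continuous.homeoOfEquivCompactToT2
    (f := Equiv.Set.image φ X.carrier hφi) (by
      refine Continuous.subtype_mk (hφ.comp continuous_subtype_val) _)
  refine ⟨Y, Ψ, fun g x => hφs g x.1, fun z x x' => ?_⟩
  change (φ x.1 z = φ x'.1 z) ↔ _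
  simp [φ, funext_iff]

/-- A polygon whose vertices are coded after passing to the patterns on translates of `G`. -/
theorem IsRecodingVia.isRecodingPolygon {A B : Type u} [TopologicalSpace A] [TopologicalSpace B]
    [Finite B] [DiscreteTopology B] {X : Subshift A (ℤ × ℤ)} {F : Finset (ℤ × ℤ)}
    {Y : Subshift B (ℤ × ℤ)} (h : IsRecodingVia X F Y) {G : Finset (ℤ × ℤ)} (hG : G.Nonempty)
    {Q : Set (ℝ × ℝ)} (hQ : IsConvexIntegerPolygon Q)
    (hcode : ∀ v : ℤ × ℤ, latticePt v ∈ polygonVertices Q → ∀ g ∈ G, v + g ∈ determined Y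
      (latticePt ⁻¹' (Q \ {latticePt v}) + (G : Set (ℤ × ℤ)))) :
    IsRecodingPolygon X Q := by
  obtain ⟨Z, hZ⟩ := exists_isRecodingVia Y G hG
  refine ⟨G → B, inferInstance, inferInstance, inferInstance, Z, h.trans hZ, hQ, ?_⟩
  intro v hv
  rw [codes_iff]
  rintro z rfl
  rw [hZ.mem_determined_iff]
  exact hcode z hv

end Recoding

/-! ### Determinants in the plane -/

theorem cross_add_right (v w w' : ℝ × ℝ) : cross v (w + w') = cross v w + cross v w' := by
  simp only [cross, Prod.fst_add, Prod.snd_add]; ring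

theorem cross_sub_right (v w w' : ℝ × ℝ) : cross v (w - w') = cross v w - cross v w' := by
  simp only [cross, Prod.fst_sub, Prod.snd_sub]; ring

theorem cross_smul_right (v w : ℝ × ℝ) (t : ℝ) : cross v (t • w) = t * cross v w := by
  simp only [cross, Prod.smul_fst, Prod.smul_snd, smul_eq_mul]; ring

theorem cross_smul_left (v w : ℝ × ℝ) (t : ℝ) : cross (t • v) w = t * cross v w := by
  simp only [cross, Prod.smul_fst, Prod.smul_snd, smul_eq_mul]; ring

theorem cross_self_eq_zero (v : ℝ × ℝ) : cross v v = 0 := by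
  simp only [cross]; ring

theorem cross_comm (v w : ℝ × ℝ) : cross v w = -cross w v := by
  simp only [cross]; ring

theorem continuous_cross (v : ℝ × ℝ) : Continuous (cross v) := by
  unfold cross; fun_prop

theorem convex_le_cross (v : ℝ × ℝ) (c : ℝ) : Convex ℝ {p | c ≤ cross v p} :=
  convex_halfSpace_ge ⟨cross_add_right v, fun t w => cross_smul_right v w t⟩ c

theorem sq_add_sq_pos {d : ℝ × ℝ} (hd : d ≠ 0) : 0 < d.1 ^ 2 + d.2 ^ 2 := by
  by_contra! h
  exact hd (Prod.ext (by simpa using by nlinarith [sq_nonneg d.1, sq_nonneg d.2] : d.1 = 0)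
    (by simpa using by nlinarith [sq_nonneg d.1, sq_nonneg d.2] : d.2 = 0))

/-- The inner product, used to compare points on a line of direction `v`. -/
def dotProd (v w : ℝ × ℝ) : ℝ := v.1 * w.1 + v.2 * w.2

theorem dotProd_self_pos {d : ℝ × ℝ} (hd : d ≠ 0) : 0 < dotProd d d := by
  have := sq_add_sq_pos hd
  unfold dotProd
  nlinarith

/-- Vectors parallel to `d` are multiples of `d`. -/
theorem eq_smul_of_cross_eq_zero {d w : ℝ × ℝ} (hd : d ≠ 0) (h : cross d w = 0) :
    w = (dotProd d w / dotProd d d) • d := by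
  have h0 := dotProd_self_pos hd
  have h1 : d.1 * w.2 - d.2 * w.1 = 0 := h
  ext
  · simp only [Prod.smul_fst, smul_eq_mul]
    rw [div_mul_eq_mul_div, eq_div_iff h0.ne']
    simp only [dotProd]
    linear_combination -d.2 * h1
  · simp only [Prod.smul_snd, smul_eq_mul]
    rw [div_mul_eq_mul_div, eq_div_iff h0.ne']
    simp only [dotProd]
    linear_combination d.1 * h1

theorem latticePt_injective : Function.Injective latticePt := fun z w h => by
  simpa [latticePt, Prod.ext_iff] using h

/-! ### Lowest faces, vertices and oriented edges of compact sets -/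

section Faces

variable {P : Set (ℝ × ℝ)}

/-- The face of a compact set in a given direction has an extreme endpoint on either side. -/
theorem exists_vertex_isMinOn (hc : IsCompact P) (hne : P.Nonempty) {d : ℝ × ℝ}
    (hd : d ≠ 0) {σ : ℝ} (hσ : σ ≠ 0) :
    ∃ q ∈ polygonVertices P, (∀ x ∈ P, cross d q ≤ cross d x) ∧
      ∀ x ∈ P, cross d x = cross d q → σ * dotProd d x ≤ σ * dotProd d q := by
  -- Lexicographic optimization: minimize `cross d`, then maximize `σ * dotProd d` on the resulting
  -- face. The sign of `σ` selects the end of the face, and the optimum is extreme.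
  obtain ⟨m, hm, hmin⟩ := hc.exists_isMinOn hne (continuous_cross d).continuousOn
  have hface : IsCompact (P ∩ {x | cross d x = cross d m}) :=
    hc.inter_right (isClosed_eq (continuous_cross d) continuous_const)
  obtain ⟨q, ⟨hq, hqm⟩, hmax⟩ := hface.exists_isMaxOn ⟨m, hm, rfl⟩
    (f := fun x => σ * dotProd d x) (by unfold dotProd; fun_prop)
  have hqm : cross d q = cross d m := hqm
  have hminq : ∀ x ∈ P, cross d q ≤ cross d x := fun x hx => by rw [hqm]; exact hmin hx
  have hmaxq : ∀ x ∈ P, cross d x = cross d q → σ * dotProd d x ≤ σ * dotProd d q :=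
    fun x hx h => hmax ⟨hx, h.trans hqm⟩
  refine ⟨q, mem_extremePoints_iff_left.2 ⟨hq, fun x hx y hy hxy => ?_⟩, hminq, hmaxq⟩
  obtain ⟨α, β, hα, hβ, hαβ, rfl⟩ := hxy
  set q := α • x + β • y with hqdef
  have h1 : cross d q = α * cross d x + β * cross d y := by
    rw [hqdef, cross_add_right, cross_smul_right, cross_smul_right]
  have h2 : dotProd d q = α * dotProd d x + β * dotProd d y := by
    simp only [hqdef, dotProd, Prod.fst_add, Prod.snd_add, Prod.smul_fst, Prod.smul_snd,
      smul_eq_mul]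
    ring
  have hx1 := hminq x hx
  have hy1 := hminq y hy
  obtain rfl : β = 1 - α := by linarith
  have hx2 : cross d x = cross d q := by nlinarith
  have hy2 : cross d y = cross d q := by nlinarith
  have hx3 := hmaxq x hx hx2
  have hy3 := hmaxq y hy hy2
  have h4 : σ * dotProd d q = α * (σ * dotProd d x) + (1 - α) * (σ * dotProd d y) := by
    rw [h2]; ring
  have hx4 : σ * dotProd d x = σ * dotProd d q := by nlinarith
  have hx5 := mul_left_cancel₀ hσ hx4
  have := eq_smul_of_cross_eq_zero hd (w := x - q) (by rw [cross_sub_right, hx2, sub_self])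
  have h0 : dotProd d (x - q) = 0 := by
    have : dotProd d (x - q) = dotProd d x - dotProd d q := by
      simp only [dotProd, Prod.fst_sub, Prod.snd_sub]; ring
    rw [this, hx5, sub_self]
  rw [h0, zero_div, zero_smul] at this
  exact sub_eq_zero.1 this

/-- In each direction, a compact set has a unique lowest vertex or a lowest oriented edge. -/
theorem exists_vertex_or_edge (hc : IsCompact P) (hne : P.Nonempty) {d : ℝ × ℝ}
    (hd : d ≠ 0) :
    (∃ p ∈ polygonVertices P, ∀ x ∈ P, x ≠ p → cross d p < cross d x) ∨
    ∃ p q, (p, q) ∈ orientedEdges P ∧ (∃ t : ℝ, 0 < t ∧ q - p = t • d) ∧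
      (∀ x ∈ P, cross d p ≤ cross d x) ∧ ∀ x ∈ P, cross d x = cross d p →
        dotProd d p ≤ dotProd d x ∧ dotProd d x ≤ dotProd d q := by
  obtain ⟨q, hq, hqmin, hqmax⟩ := exists_vertex_isMinOn hc hne hd one_ne_zero
  obtain ⟨p, hp, hpmin, hpmax⟩ := exists_vertex_isMinOn hc hne hd (neg_ne_zero.2 one_ne_zero)
  have hpq : cross d q = cross d p := le_antisymm (hqmin p hp.1) (hpmin q hq.1)
  have hdir := eq_smul_of_cross_eq_zero hd (w := q - p) (by rw [cross_sub_right, hpq, sub_self])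
  have hface : ∀ x ∈ P, cross d x = cross d p →
        dotProd d p ≤ dotProd d x ∧ dotProd d x ≤ dotProd d q := fun x hx h => by
    have h1 := hqmax x hx (h.trans hpq.symm)
    have h2 := hpmax x hx h
    constructor <;> linarith
  have hsub : ∀ x y, dotProd d (x - y) = dotProd d x - dotProd d y := fun x y => by
    simp only [dotProd, Prod.fst_sub, Prod.snd_sub]; ring
  have h0 := dotProd_self_pos hd
  rcases (hface q hq.1 hpq).1.eq_or_lt with h | h
  · left
    refine ⟨p, hp, fun x hx hxp => lt_of_le_of_ne (hpmin x hx) fun hx' => hxp ?_⟩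
    have h1 := eq_smul_of_cross_eq_zero hd (w := x - p)
      (by rw [cross_sub_right, hx', sub_self])
    have h2 := hface x hx hx'.symm
    rw [hsub, show dotProd d x - dotProd d p = 0 by linarith, zero_div, zero_smul] at h1
    exact sub_eq_zero.1 h1
  · right
    have ht : 0 < dotProd d (q - p) / dotProd d d := by
      rw [hsub]
      exact div_pos (by linarith) h0
    refine ⟨p, q, ⟨hp, hq, ?_, fun x hx => ?_⟩, ⟨_, ht, hdir⟩, hpmin, hface⟩
    · rintro (rfl : p = q)
      exact h.ne rfl
    · change 0 ≤ cross (q - p) (x - p)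
      rw [hdir, cross_smul_left, cross_sub_right]
      exact mul_nonneg ht.le (by linarith [hpmin x hx])

theorem mem_openSegment_add_smul {v d : ℝ × ℝ} {s t : ℝ} (hs : 0 < s) (ht : 0 < t) :
    v ∈ openSegment ℝ (v + s • d) (v + -t • d) := by
  have : 0 < s + t := add_pos hs ht
  refine ⟨t / (s + t), s / (s + t), by positivity, by positivity, by field_simp; ring, ?_⟩
  ext <;> simp only [Prod.fst_add, Prod.snd_add, Prod.smul_fst, Prod.smul_snd, smul_eq_mul] <;>
    field_simp <;> ring

theorem not_both_sides {v d : ℝ × ℝ} {s t : ℝ} (hv : v ∈ polygonVertices P) (hd : d ≠ 0)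
    (hs : 0 < s) (ht : 0 < t) (h1 : v + s • d ∈ P) (h2 : v + -t • d ∈ P) : False := by
  have h := (mem_extremePoints_iff_left.1 hv).2 _ h1 _ h2 (mem_openSegment_add_smul hs ht)
  rw [add_eq_left, smul_eq_zero] at h
  exact h.elim hs.ne' hd

/-- Both `v` and `w` are lowest in direction `w - v`, so the lowest face is an edge. It must start
at `v`, as otherwise the extreme point `v` would lie strictly between its initial vertex and `w`. -/
theorem exists_edge_of_left (hc : IsCompact P) {v w : ℝ × ℝ}
    (hv : v ∈ polygonVertices P) (hw : w ∈ P) (hne : w ≠ v)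
    (h : ∀ p ∈ P, 0 ≤ cross (w - v) (p - v)) : ∃ q, (v, q) ∈ orientedEdges P := by
  have hd : w - v ≠ 0 := sub_ne_zero.2 hne
  have hvmin : ∀ p ∈ P, cross (w - v) v ≤ cross (w - v) p := fun p hp => by
    have := h p hp
    rw [cross_sub_right] at this
    linarith
  have hvw : cross (w - v) w = cross (w - v) v := by
    have := cross_self_eq_zero (w - v)
    rw [cross_sub_right] at this
    linarith
  rcases exists_vertex_or_edge hc ⟨v, hv.1⟩ hd with ⟨p, hp, hlt⟩ | ⟨p, q, he, -, hmin, hface⟩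
  · exfalso
    by_cases hvp : v = p
    · subst hvp
      exact (hlt w hw hne).ne' hvw
    · exact (hlt v hv.1 hvp).not_ge (hvmin p hp.1)
  · have hp : p ∈ P := he.1.1
    have hpv := le_antisymm (hmin v hv.1) (hvmin p hp)
    have hle := (hface v hv.1 hpv.symm).1
    have hdir := eq_smul_of_cross_eq_zero hd (w := p - v)
      (by rw [cross_sub_right, hpv, sub_self])
    have hsub : dotProd (w - v) (p - v) = dotProd (w - v) p - dotProd (w - v) v := by
      simp only [dotProd, Prod.fst_sub, Prod.snd_sub]; ring
    rcases hle.eq_or_lt with hle | hlt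
    · rw [hsub, hle, sub_self, zero_div, zero_smul, sub_eq_zero] at hdir
      exact ⟨q, hdir ▸ he⟩
    · exfalso
      refine not_both_sides hv hd one_pos (t := -(dotProd (w - v) (p - v) /
        dotProd (w - v) (w - v))) ?_ (by simpa using hw) ?_
      · rw [hsub, neg_pos]
        exact div_neg_of_neg_of_pos (by linarith) (dotProd_self_pos hd)
      · rw [neg_neg, ← hdir]
        simpa using hp

theorem exists_edge_of_right (hc : IsCompact P) {v w : ℝ × ℝ}
    (hv : v ∈ polygonVertices P) (hw : w ∈ P) (hne : w ≠ v)
    (h : ∀ p ∈ P, cross (w - v) (p - v) ≤ 0) : ∃ q, (q, v) ∈ orientedEdges P := by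
  have hd : v - w ≠ 0 := sub_ne_zero.2 hne.symm
  have hvmin : ∀ p ∈ P, cross (v - w) v ≤ cross (v - w) p := fun p hp => by
    have := h p hp
    simp only [cross, Prod.fst_sub, Prod.snd_sub] at this ⊢
    linarith
  have hvw : cross (v - w) w = cross (v - w) v := by
    simp only [cross, Prod.fst_sub, Prod.snd_sub]
    ring
  rcases exists_vertex_or_edge hc ⟨v, hv.1⟩ hd with ⟨p, hp, hlt⟩ | ⟨p, q, he, ⟨t, -, ht⟩, hmin, hface⟩
  · exfalso
    by_cases hvp : v = p
    · subst hvp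
      exact (hlt w hw hne).ne' hvw
    · exact (hlt v hv.1 hvp).not_ge (hvmin p hp.1)
  · have hp : p ∈ P := he.1.1
    have hq : q ∈ P := he.2.1.1
    have hpv := le_antisymm (hmin v hv.1) (hvmin p hp)
    have hqp : cross (v - w) q = cross (v - w) p := by
      rw [← sub_eq_zero, ← cross_sub_right, ht, cross_smul_right, cross_self_eq_zero, mul_zero]
    have hle := (hface v hv.1 hpv.symm).2
    have hdir := eq_smul_of_cross_eq_zero hd (w := q - v)
      (by rw [cross_sub_right, hqp, hpv, sub_self])
    have hsub : dotProd (v - w) (q - v) = dotProd (v - w) q - dotProd (v - w) v := by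
      simp only [dotProd, Prod.fst_sub, Prod.snd_sub]; ring
    rcases hle.eq_or_lt with hle | hlt
    · rw [hsub, hle, sub_self, zero_div, zero_smul, sub_eq_zero] at hdir
      exact ⟨p, hdir ▸ he⟩
    · exfalso
      refine not_both_sides hv hd (s := dotProd (v - w) (q - v) /
        dotProd (v - w) (v - w)) (t := 1) ?_ one_pos ?_ (by simpa using hw)
      · rw [hsub]
        exact div_pos (by linarith) (dotProd_self_pos hd)
      · rw [← hdir]
        simpa using hq

/-- Each of `w`, `w'` lies to the left of the edge to the other, so `v`, `w`, `w'` are collinear; as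
all three are extreme, two of them must coincide. -/
theorem orientedEdges_right_unique {v w w' : ℝ × ℝ} (h : (v, w) ∈ orientedEdges P)
    (h' : (v, w') ∈ orientedEdges P) : w = w' := by
  obtain ⟨hv, hw, hne, hl⟩ := h
  obtain ⟨-, hw', hne', hl'⟩ := h'
  have hd : w - v ≠ 0 := sub_ne_zero.2 (Ne.symm hne)
  have h1 : 0 ≤ cross (w - v) (w' - v) := hl w' hw'.1
  have h2 : 0 ≤ cross (w' - v) (w - v) := hl' w hw.1
  rw [cross_comm] at h2
  have hdir := eq_smul_of_cross_eq_zero hd (le_antisymm (by linarith) h1)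
  generalize dotProd (w - v) (w' - v) / dotProd (w - v) (w - v) = t at hdir
  have hw'eq : w' = v + t • (w - v) := by rw [← hdir]; abel
  rcases lt_trichotomy t 0 with ht | rfl | ht
  · exact (not_both_sides hv hd one_pos (neg_pos.2 ht) (by simpa using hw.1)
      (by rw [neg_neg, ← hw'eq]; exact hw'.1)).elim
  · exact (hne' (by simpa using hw'eq.symm)).elim
  · rcases lt_trichotomy t 1 with ht1 | rfl | ht1
    · refine (not_both_sides hw' hd (s := 1 - t) (t := t) (by linarith) ht ?_ ?_).elim
      · convert hw.1 using 1
        rw [hw'eq]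
        module
      · convert hv.1 using 1
        rw [hw'eq]
        module
    · rw [hw'eq]; module
    · refine (not_both_sides hw hd (s := t - 1) (t := 1) (by linarith) one_pos ?_ ?_).elim
      · convert hw'.1 using 1
        rw [hw'eq]
        module
      · convert hv.1 using 1
        module

theorem exists_smul_of_mem_edge_line {p q x : ℝ × ℝ} (he : (p, q) ∈ orientedEdges P) (hx : x ∈ P)
    (h : cross (q - p) (x - p) = 0) : ∃ t : ℝ, 0 ≤ t ∧ t ≤ 1 ∧ x = p + t • (q - p) := by
  obtain ⟨hp, hq, hne, -⟩ := he
  have hd : q - p ≠ 0 := sub_ne_zero.2 (Ne.symm hne)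
  have hdir := eq_smul_of_cross_eq_zero hd h
  generalize dotProd (q - p) (x - p) / dotProd (q - p) (q - p) = t at hdir
  have hxeq : x = p + t • (q - p) := by rw [← hdir]; abel
  refine ⟨t, ?_, ?_, hxeq⟩
  · by_contra! ht
    exact not_both_sides hp hd one_pos (neg_pos.2 ht) (by simpa using hq.1)
      (by rw [neg_neg, ← hxeq]; exact hx)
  · by_contra! ht
    refine not_both_sides hq hd (s := t - 1) (t := 1) (by linarith) one_pos ?_ ?_
    · convert hx using 1
      rw [hxeq]
      module
    · convert hp.1 using 1
      module

/-- At a common vertex of two consecutive edges, a nondegenerate polygon turns strictly left. -/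
theorem cross_consecutive_pos {p q r x : ℝ × ℝ} (h : (p, q) ∈ orientedEdges P)
    (h' : (q, r) ∈ orientedEdges P) (hx : x ∈ P)
    (hxpos : 0 < cross (q - p) (x - p) ∨ 0 < cross (r - q) (x - q)) :
    0 < cross (q - p) (r - q) := by
  obtain ⟨hp, hq, hne, hl⟩ := h
  obtain ⟨-, hr, hne', hl'⟩ := h'
  have hd : q - p ≠ 0 := sub_ne_zero.2 (Ne.symm hne)
  have h1 : 0 ≤ cross (q - p) (r - p) := hl r hr.1
  have hself : cross (q - p) (r - q) = cross (q - p) (r - p) := by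
    simp only [cross, Prod.fst_sub, Prod.snd_sub]
    ring
  rw [hself]
  refine lt_of_le_of_ne h1 fun h0 => ?_
  -- If there were no turn, `r - q` would be a multiple `t` of `q - p`. For `t > 0` the extreme
  -- point `q` lies between `p` and `r`; for `t < 0` the two left conditions force `x` onto the
  -- line.
  have hdir := eq_smul_of_cross_eq_zero hd (w := r - q) (by rw [hself, ← h0])
  generalize dotProd (q - p) (r - q) / dotProd (q - p) (q - p) = t at hdir
  have hreq : r = q + t • (q - p) := by rw [← hdir]; abel
  have h2 : 0 ≤ cross (r - q) (x - q) := hl' x hx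
  have h3 : 0 ≤ cross (q - p) (x - p) := hl x hx
  have h4 : cross (r - q) (x - q) = t * cross (q - p) (x - p) := by
    rw [hdir, cross_smul_left]
    simp only [cross, Prod.fst_sub, Prod.snd_sub]
    ring
  rcases lt_trichotomy t 0 with ht | rfl | ht
  · rcases hxpos with hpos | hpos <;> nlinarith
  · exact hne' (by simpa using hreq.symm)
  · refine not_both_sides hq hd (s := t) (t := 1) ht one_pos (by rw [← hreq]; exact hr.1) ?_
    convert hp.1 using 1
    module

end Faces

/-! ### Adjacent edges at a vertex, and the vertex count of integer polygons -/

section Hull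

variable {S : Set (ℝ × ℝ)}

/-- A functional `f` separating `v` from the hull of the other points is positive on all `p - v`, so
these vectors are ordered by the slope `cross n (p - v) / f (p - v)`, with `n` the coefficient
vector of `f`. Points of least and greatest slope span the two supporting lines. -/
theorem exists_extremal_directions (hS : S.Finite) (hS' : S.Nontrivial) {v : ℝ × ℝ}
    (hv : v ∈ polygonVertices (convexHull ℝ S)) :
    (∃ w ∈ convexHull ℝ S, w ≠ v ∧ ∀ p ∈ convexHull ℝ S, 0 ≤ cross (w - v) (p - v)) ∧
    (∃ w ∈ convexHull ℝ S, w ≠ v ∧ ∀ p ∈ convexHull ℝ S, cross (w - v) (p - v) ≤ 0) := by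
  have hfin : (S \ {v}).Finite := hS.subset Set.sdiff_subset
  have hne : (S \ {v}).Nonempty := hS'.exists_ne v |>.imp fun w hw => ⟨hw.1, hw.2⟩
  have hv' : v ∉ convexHull ℝ (S \ {v}) := fun h =>
    ((convex_convexHull ℝ S).mem_extremePoints_iff_mem_sdiff_convexHull_sdiff.1 hv).2
      (convexHull_mono (Set.sdiff_subset_sdiff_left (subset_convexHull ℝ S)) h)
  obtain ⟨f, u, hfv, hf⟩ := geometric_hahn_banach_point_closed (convex_convexHull ℝ _)
    (hfin.isClosed_convexHull ℝ) hv'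
  have hpos : ∀ p ∈ S \ {v}, 0 < f (p - v) := fun p hp => by
    rw [map_sub]
    linarith [hf p (subset_convexHull ℝ _ hp)]
  let n : ℝ × ℝ := (f (1, 0), f (0, 1))
  have hfn : ∀ x : ℝ × ℝ, f x = n.1 * x.1 + n.2 * x.2 := fun x => by
    have : x = x.1 • ((1, 0) : ℝ × ℝ) + x.2 • ((0, 1) : ℝ × ℝ) := by ext <;> simp
    conv_lhs => rw [this]
    rw [map_add, map_smul, map_smul]
    simp only [n, smul_eq_mul]
    ring
  have hn : n ≠ 0 := by
    obtain ⟨p, hp⟩ := hne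
    intro h0
    have := hpos p hp
    rw [hfn, h0] at this
    simp at this
  have hn' := sq_add_sq_pos hn
  have key : ∀ w ∈ S \ {v}, ∀ p ∈ S \ {v},
      cross n (w - v) / f (w - v) ≤ cross n (p - v) / f (p - v) → 0 ≤ cross (w - v) (p - v) := by
    intro w hw p hp h
    rw [div_le_div_iff₀ (hpos w hw) (hpos p hp), hfn, hfn] at h
    have : (n.1 ^ 2 + n.2 ^ 2) * cross (w - v) (p - v) =
        cross n (p - v) * (n.1 * (w - v).1 + n.2 * (w - v).2) -
        cross n (w - v) * (n.1 * (p - v).1 + n.2 * (p - v).2) := by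
      simp only [cross]
      ring
    by_contra! hlt
    nlinarith
  have hconv : ∀ d : ℝ × ℝ, (∀ p ∈ S \ {v}, 0 ≤ cross d (p - v)) →
      ∀ p ∈ convexHull ℝ S, 0 ≤ cross d (p - v) := by
    intro d hd p hp
    have := convexHull_min (t := {p | cross d v ≤ cross d p}) (fun q hq => ?_)
      (convex_le_cross d _) hp
    · rw [cross_sub_right]
      exact sub_nonneg.2 this
    · by_cases hqv : q = v
      · exact (congrArg (cross d) hqv).ge
      · have := hd q ⟨hq, hqv⟩
        rw [cross_sub_right] at this
        exact sub_nonneg.1 this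
  constructor
  · obtain ⟨w, hw, hmin⟩ := Set.exists_min_image _ (fun p => cross n (p - v) / f (p - v)) hfin hne
    exact ⟨w, subset_convexHull ℝ S hw.1, hw.2, hconv _ fun p hp => key w hw p hp (hmin p hp)⟩
  · obtain ⟨w, hw, hmax⟩ := Set.exists_max_image _ (fun p => cross n (p - v) / f (p - v)) hfin hne
    refine ⟨w, subset_convexHull ℝ S hw.1, hw.2, fun p hp => ?_⟩
    have := hconv (-(w - v)) (fun p hp => ?_) p hp
    · simp only [cross, Prod.fst_neg, Prod.snd_neg] at this ⊢
      linarith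
    · have := key p hp w hw (hmax p hp)
      simp only [cross, Prod.fst_neg, Prod.snd_neg] at this ⊢
      linarith

end Hull

theorem IsConvexIntegerPolygon.exists_next {P : Set (ℝ × ℝ)} (hP : IsConvexIntegerPolygon P)
    {v : ℝ × ℝ} (hv : v ∈ polygonVertices P) : ∃ w, (v, w) ∈ orientedEdges P := by
  obtain ⟨V, hV, rfl⟩ := hP
  have hfin := V.finite_toSet.image latticePt
  obtain ⟨⟨w, hw, hne, h⟩, -⟩ :=
    exists_extremal_directions hfin (hV.image latticePt_injective) hv
  exact exists_edge_of_left (hfin.isCompact_convexHull ℝ) hv hw hne h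

theorem IsConvexIntegerPolygon.exists_prev {P : Set (ℝ × ℝ)} (hP : IsConvexIntegerPolygon P)
    {v : ℝ × ℝ} (hv : v ∈ polygonVertices P) : ∃ w, (w, v) ∈ orientedEdges P := by
  obtain ⟨V, hV, rfl⟩ := hP
  have hfin := V.finite_toSet.image latticePt
  obtain ⟨-, w, hw, hne, h⟩ :=
    exists_extremal_directions hfin (hV.image latticePt_injective) hv
  exact exists_edge_of_right (hfin.isCompact_convexHull ℝ) hv hw hne h

theorem IsConvexIntegerPolygon.isCompact {P : Set (ℝ × ℝ)} (hP : IsConvexIntegerPolygon P) :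
    IsCompact P := by
  obtain ⟨V, -, rfl⟩ := hP
  exact (V.finite_toSet.image latticePt).isCompact_convexHull ℝ

theorem IsConvexIntegerPolygon.nonempty {P : Set (ℝ × ℝ)} (hP : IsConvexIntegerPolygon P) :
    P.Nonempty := by
  obtain ⟨V, hV, rfl⟩ := hP
  obtain ⟨v, hv⟩ := hV.nonempty
  exact ⟨_, subset_convexHull ℝ _ ⟨v, hv, rfl⟩⟩

theorem IsConvexIntegerPolygon.convex {P : Set (ℝ × ℝ)} (hP : IsConvexIntegerPolygon P) :
    Convex ℝ P := by
  obtain ⟨V, -, rfl⟩ := hP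
  exact convex_convexHull ℝ _

theorem mem_of_mem_polygonVertices {V : Set (ℤ × ℤ)} {v : ℝ × ℝ}
    (hv : v ∈ polygonVertices (convexHull ℝ (latticePt '' V))) : ∃ z ∈ V, latticePt z = v := by
  have h : v ∈ latticePt '' V := extremePoints_convexHull_subset hv
  exact h

theorem IsConvexIntegerPolygon.exists_latticePt_eq {P : Set (ℝ × ℝ)}
    (hP : IsConvexIntegerPolygon P) {v : ℝ × ℝ} (hv : v ∈ polygonVertices P) :
    ∃ z, latticePt z = v := by
  obtain ⟨V, -, rfl⟩ := hP
  exact (mem_of_mem_polygonVertices hv).imp fun _ h => h.2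

theorem IsConvexIntegerPolygon.finite_vertices {P : Set (ℝ × ℝ)}
    (hP : IsConvexIntegerPolygon P) : (polygonVertices P).Finite := by
  obtain ⟨V, -, rfl⟩ := hP
  exact (V.finite_toSet.image latticePt).subset extremePoints_convexHull_subset

theorem IsConvexIntegerPolygon.finite_latticePts {P : Set (ℝ × ℝ)}
    (hP : IsConvexIntegerPolygon P) : (latticePt ⁻¹' P).Finite := by
  obtain ⟨R, hR⟩ := hP.isCompact.isBounded.exists_norm_le
  refine ((Set.finite_Icc (-⌈R⌉) ⌈R⌉).prod (Set.finite_Icc (-⌈R⌉) ⌈R⌉)).subset fun z hz => ?_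
  have h := hR _ hz
  have h1 := abs_le.1 ((norm_fst_le (latticePt z)).trans h)
  have h2 := abs_le.1 ((norm_snd_le (latticePt z)).trans h)
  have hR' := Int.le_ceil R
  simp only [latticePt] at h1 h2
  refine ⟨⟨?_, ?_⟩, ⟨?_, ?_⟩⟩ <;> rify <;> linarith

/-- A convex integer polygon has as many sides as vertices. -/
theorem IsConvexIntegerPolygon.numSides_eq {P : Set (ℝ × ℝ)} (hP : IsConvexIntegerPolygon P) :
    numSides P = (polygonVertices P).encard := by
  have h : polygonVertices P = Prod.fst '' orientedEdges P := by
    ext v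
    constructor
    · intro hv
      obtain ⟨w, hw⟩ := hP.exists_next hv
      exact ⟨_, hw, rfl⟩
    · rintro ⟨e, he, rfl⟩
      exact he.1
  rw [h, Set.InjOn.encard_image, numSides]
  rintro ⟨v, w⟩ h ⟨v', w'⟩ h' (rfl : v = v')
  rw [orientedEdges_right_unique h h']

/-! ### Integer determinants and edges with lattice endpoints -/

/-- The determinant of two lattice vectors. -/
def latticeCross (v w : ℤ × ℤ) : ℤ := v.1 * w.2 - v.2 * w.1

theorem cross_latticePt (v w : ℤ × ℤ) :
    cross (latticePt v) (latticePt w) = (latticeCross v w : ℝ) := by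
  simp [cross, latticePt, latticeCross]

theorem latticeCross_add (v w w' : ℤ × ℤ) :
    latticeCross v (w + w') = latticeCross v w + latticeCross v w' := by
  simp only [latticeCross, Prod.fst_add, Prod.snd_add]; ring

theorem latticeCross_sub (v w w' : ℤ × ℤ) :
    latticeCross v (w - w') = latticeCross v w - latticeCross v w' := by
  simp only [latticeCross, Prod.fst_sub, Prod.snd_sub]; ring

theorem latticeCross_smul (v w : ℤ × ℤ) (k : ℤ) :
    latticeCross v (k • w) = k * latticeCross v w := by
  simp only [latticeCross, Prod.smul_fst, Prod.smul_snd, smul_eq_mul]; ring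

theorem latticeCross_zero (v : ℤ × ℤ) : latticeCross v 0 = 0 := by
  simp [latticeCross]

theorem latticeCross_self (v : ℤ × ℤ) : latticeCross v v = 0 := by
  simp only [latticeCross]; ring

theorem latticeCross_comm (v w : ℤ × ℤ) : latticeCross v w = -latticeCross w v := by
  simp only [latticeCross]; ring

/-- This measures rows of a wedge: on a fixed level of `d`, a weighted sum of the distances to the
two sides is constant, and it varies with the level at the rate `latticeCross w u`. -/
theorem latticeCross_relation (d u w z : ℤ × ℤ) :
    latticeCross u d * latticeCross w z + latticeCross d w * latticeCross u z +
      latticeCross w u * latticeCross d z = 0 := by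
  simp only [latticeCross]; ring

theorem exists_latticeCross_eq_one {d : ℤ × ℤ} (hd : IsCoprime d.1 d.2) :
    ∃ z, latticeCross d z = 1 := by
  obtain ⟨a, b, h⟩ := hd
  exact ⟨(-b, a), by simp only [latticeCross]; linarith⟩

theorem exists_eq_smul_of_latticeCross_eq_zero {d z : ℤ × ℤ} (hd : IsCoprime d.1 d.2)
    (h : latticeCross d z = 0) : ∃ k : ℤ, z = k • d := by
  obtain ⟨a, b, hab⟩ := hd
  refine ⟨a * z.1 + b * z.2, ?_⟩
  simp only [latticeCross] at h
  ext <;> simp only [Prod.smul_fst, Prod.smul_snd, smul_eq_mul]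
  · linear_combination -z.1 * hab - b * h
  · linear_combination -z.2 * hab + a * h

/-- The lattice points of a polygon with an edge from `p` to `p + L • d`, where `d` is primitive,
both of whose endpoints are coded. -/
structure EdgeCoding {A : Type*} [TopologicalSpace A] (X : Subshift A (ℤ × ℤ)) (S : Set (ℤ × ℤ))
    (p d : ℤ × ℤ) (L : ℤ) : Prop where
  coprime : IsCoprime d.1 d.2
  finite : S.Finite
  pos : 0 < L
  left : ∀ s ∈ S, 0 ≤ latticeCross d (s - p)
  line : ∀ s ∈ S, latticeCross d (s - p) = 0 → ∃ j : ℤ, 0 ≤ j ∧ j ≤ L ∧ s = p + j • d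
  init : p ∈ determined X (S \ {p})
  term : p + L • d ∈ determined X (S \ {p + L • d})

/-! ### Propagation of colors along rows and down a wedge -/

section Rows

variable {A : Type*} [TopologicalSpace A] {X : Subshift A (ℤ × ℤ)} {S : Set (ℤ × ℤ)}
  {p d u w : ℤ × ℤ} {L : ℤ}

/-- A block of length `L` in a row and the region `W` above the row code the part of the row
in `W`. -/
theorem EdgeCoding.row_subset (h : EdgeCoding X S p d L) {C W : Set (ℤ × ℤ)} {r : ℤ}
    {q : ℤ × ℤ} (hC : determined X C ⊆ C)
    (hWS : ∀ z ∈ W, z + L • d ∈ W → ∀ s ∈ S, z + (s - p) ∈ W)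
    (hWc : ∀ z ∈ W, ∀ k : ℤ, z + k • d ∈ W → ∀ j, 0 ≤ j → j ≤ k → z + j • d ∈ W)
    (hup : ∀ z ∈ W, ∀ s ∈ S, 0 < latticeCross d (s - p) → latticeCross d z = r →
      z + (s - p) ∈ W → z + (s - p) ∈ C)
    (hq : latticeCross d q = r)
    (hblock : ∀ j, 0 ≤ j → j < L → q + j • d ∈ W ∧ q + j • d ∈ C) :
    ∀ z ∈ W, latticeCross d z = r → z ∈ C := by
  have hrow : ∀ k : ℤ, latticeCross d (q + k • d) = r := fun k => by
    rw [latticeCross_add, latticeCross_smul, latticeCross_self, hq]; ring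
  have hLpos := h.pos
  have hq0 : q ∈ W := by simpa using (hblock 0 le_rfl hLpos).1
  have up : ∀ n : ℕ, q + (n : ℤ) • d ∈ W → q + (n : ℤ) • d ∈ C := by
    intro n
    induction n using Nat.strong_induction_on with
    | _ n ih =>
    intro hn
    rcases lt_or_ge (n : ℤ) L with hnL | hnL
    · exact (hblock n (by positivity) hnL).2
    · refine hC ?_
      have hz : q + ((n : ℤ) - L) • d ∈ W := hWc q hq0 n hn _ (by linarith) (by linarith)
      have hz' : q + ((n : ℤ) - L) • d + L • d ∈ W := by convert hn using 1; module
      have := add_mem_determined (T := C) (q + ((n : ℤ) - L) • d - p) h.term ?_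
      · convert this using 1; module
      · rintro s ⟨hs, hsne⟩
        refine subset_determined _ ?_
        rcases (h.left s hs).eq_or_lt with h0 | hpos
        · obtain ⟨j, hj0, hjL, rfl⟩ := h.line s hs h0.symm
          have hjL' : j < L := lt_of_le_of_ne hjL fun hj => hsne (by rw [hj]; rfl)
          obtain ⟨m, hm⟩ := Int.eq_ofNat_of_zero_le (show 0 ≤ (n : ℤ) - L + j by linarith)
          have := ih m (by omega) (by
            rw [← hm]
            exact hWc q hq0 n hn _ (by linarith) (by linarith))
          rw [← hm] at this
          convert this using 1; module
        · have := hup _ hz s hs hpos (hrow _) (hWS _ hz hz' s hs)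
          convert this using 1; module
  have down : ∀ n : ℕ, q + (-(n : ℤ)) • d ∈ W → q + (-(n : ℤ)) • d ∈ C := by
    intro n
    induction n using Nat.strong_induction_on with
    | _ n ih =>
    intro hn
    rcases Nat.eq_zero_or_pos n with rfl | hn0
    · simpa using (hblock 0 le_rfl hLpos).2
    have hbet : ∀ j : ℤ, 0 ≤ j → j ≤ n → q + (j - (n : ℤ)) • d ∈ W := fun j hj hjn => by
      have := hWc _ hn n (by convert hq0 using 1; module) j hj hjn
      convert this using 1; module
    refine hC ?_
    have hz' : q + (-(n : ℤ)) • d + L • d ∈ W := by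
      rcases le_total (n : ℤ) L with hnL | hnL
      · convert (hblock (L - n) (by linarith) (by omega)).1 using 1; module
      · convert hbet L hLpos.le hnL using 1; module
    have := add_mem_determined (T := C) (q + (-(n : ℤ)) • d - p) h.init ?_
    · convert this using 1; module
    · rintro s ⟨hs, hsne⟩
      refine subset_determined _ ?_
      rcases (h.left s hs).eq_or_lt with h0 | hpos
      · obtain ⟨j, hj0, hjL, rfl⟩ := h.line s hs h0.symm
        have hj0' : 0 < j := lt_of_le_of_ne hj0 fun hj => hsne (by simp [← hj])
        rcases le_or_gt (n : ℤ) j with hnj | hnj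
        · convert (hblock (j - n) (by linarith) (by omega)).2 using 1; module
        · obtain ⟨m, hm⟩ := Int.eq_ofNat_of_zero_le (show 0 ≤ (n : ℤ) - j by linarith)
          have h1 : -(m : ℤ) = j - n := by omega
          have := ih m (by omega) (by
            rw [h1]
            exact hbet j hj0 hnj.le)
          rw [h1] at this
          convert this using 1; module
      · have := hup _ hn s hs hpos (hrow _) (hWS _ hn hz' s hs)
        convert this using 1; module
  intro z hz hzr
  obtain ⟨k, hk⟩ := exists_eq_smul_of_latticeCross_eq_zero (z := z - q) h.coprime
    (by rw [latticeCross_sub, hzr, hq, sub_self])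
  obtain rfl : z = q + k • d := by rw [← hk]; abel
  obtain ⟨n, rfl | rfl⟩ := k.eq_nat_or_neg
  · exact up n hz
  · exact down n hz

/-- If the half plane to the left of the edge codes everything, then a region `W` in which
there is enough room codes the next row of `W`. -/
theorem EdgeCoding.row_subset_of_room (h : EdgeCoding X S p d L) {C W : Set (ℤ × ℤ)} {r ρ : ℤ}
    {q : ℤ × ℤ} (hC : determined X C ⊆ C)
    (hWS : ∀ z ∈ W, z + L • d ∈ W → ∀ s ∈ S, z + (s - p) ∈ W)
    (hWc : ∀ z ∈ W, ∀ k : ℤ, z + k • d ∈ W → ∀ j, 0 ≤ j → j ≤ k → z + j • d ∈ W)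
    {K : Finset (ℤ × ℤ)} (hK : 0 ∈ determined X K)
    (hKρ : ∀ k ∈ K, 0 < latticeCross d k ∧ latticeCross d k ≤ ρ)
    (hSρ : ∀ s ∈ S, latticeCross d (s - p) ≤ ρ)
    (hup : ∀ z ∈ W, r < latticeCross d z → latticeCross d z ≤ r + ρ → z ∈ C)
    (hq : latticeCross d q = r)
    (hroom : ∀ j, 0 ≤ j → j < L → q + j • d ∈ W ∧ ∀ k ∈ K, q + j • d + k ∈ W) :
    ∀ z ∈ W, latticeCross d z = r → z ∈ C := by
  refine h.row_subset hC hWS hWc (fun z _ s hs hpos hzr hzs => hup _ hzs ?_ ?_) hq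
    fun j hj hjL => ⟨(hroom j hj hjL).1, hC ?_⟩
  · rw [latticeCross_add]; linarith
  · rw [latticeCross_add]; linarith [hSρ s hs]
  · rw [← add_zero (q + j • d)]
    refine add_mem_determined _ hK fun k hk => subset_determined _
      (hup _ ((hroom j hj hjL).2 k hk) ?_ ?_) <;>
    · rw [latticeCross_add, latticeCross_add, latticeCross_smul, latticeCross_self, hq]
      linarith [hKρ k hk]

/-- The region between two lines of directions `u` and `w`. -/
def wedge (u w : ℤ × ℤ) (M : ℤ) : Set (ℤ × ℤ) :=
  {z | 0 ≤ latticeCross u z ∧ -M ≤ latticeCross w z}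

/-- The coordinates `latticeCross u z` and `latticeCross d z` determine `z`, and
`latticeCross_relation` bounds the first one once the level is bounded. -/
theorem finite_wedge_slab (hu : 0 < latticeCross u d) (hw : 0 < latticeCross d w) (M t t' : ℤ) :
    {z ∈ wedge u w M | t ≤ latticeCross d z ∧ latticeCross d z < t'}.Finite := by
  let B := latticeCross u d * M + |latticeCross w u| * (|t| + |t'|)
  refine (Set.Finite.preimage (f := fun z => (latticeCross u z, latticeCross d z)) ?_
    ((Set.finite_Icc 0 B).prod (Set.finite_Icc t t'))).subset ?_
  · intro z _ z' _ hzz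
    simp only [Prod.mk.injEq] at hzz
    obtain ⟨h1, h2⟩ := hzz
    have e1 : latticeCross u d * (z.1 - z'.1) = 0 := by
      simp only [latticeCross] at h1 h2 ⊢
      linear_combination d.1 * h1 - u.1 * h2
    have e2 : latticeCross u d * (z.2 - z'.2) = 0 := by
      simp only [latticeCross] at h1 h2 ⊢
      linear_combination d.2 * h1 - u.2 * h2
    ext
    · rcases mul_eq_zero.1 e1 with h | h <;> omega
    · rcases mul_eq_zero.1 e2 with h | h <;> omega
  · rintro z ⟨⟨hz1, hz2⟩, ht, ht'⟩
    refine ⟨⟨hz1, ?_⟩, ht, ht'.le⟩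
    have hrel := latticeCross_relation d u w z
    have hlev : |latticeCross d z| ≤ |t| + |t'| := by
      rw [abs_le]
      constructor <;> linarith [neg_abs_le t, le_abs_self t', abs_nonneg t, abs_nonneg t']
    have h1 : -(latticeCross w u * latticeCross d z) ≤ |latticeCross w u| * (|t| + |t'|) := by
      refine (neg_le_abs _).trans ?_
      rw [abs_mul]
      gcongr
    have h2 : latticeCross u d * -M ≤ latticeCross u d * latticeCross w z := by gcongr
    have h3 : latticeCross u z ≤ latticeCross d w * latticeCross u z :=
      le_mul_of_one_le_left hz1 hw
    change latticeCross u z ≤ latticeCross u d * M + |latticeCross w u| * (|t| + |t'|)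
    linarith

/-- In a wedge that is wide enough, each row is coded by the rows above it. -/
theorem EdgeCoding.exists_wedge_row [Finite A] [DiscreteTopology A] (h : EdgeCoding X S p d L)
    (hexp : 0 ∈ determined X {z | 0 < latticeCross d z})
    (hu : 0 < latticeCross u d) (hw : 0 < latticeCross d w)
    (hSu : ∀ s ∈ S, 0 ≤ latticeCross u (s - p))
    (hSw : ∀ s ∈ S, 0 ≤ latticeCross w (s - (p + L • d))) :
    ∃ ρ N : ℤ, 0 < ρ ∧ 0 ≤ N ∧ ∀ (M r : ℤ) (C : Set (ℤ × ℤ)), determined X C ⊆ C →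
      N ≤ latticeCross u d * M - latticeCross w u * r →
      (∀ z ∈ wedge u w M, r < latticeCross d z → latticeCross d z ≤ r + ρ → z ∈ C) →
      ∀ z ∈ wedge u w M, latticeCross d z = r → z ∈ C := by
  obtain ⟨K, hKpos, hK⟩ := exists_finite_of_mem_determined hexp
  obtain ⟨ρ₁, hρ₁⟩ := (K.finite_toSet.image (latticeCross d)).bddAbove
  obtain ⟨ρ₂, hρ₂⟩ := (h.finite.image fun s => latticeCross d (s - p)).bddAbove
  obtain ⟨κ₁, hκ₁⟩ := (K.finite_toSet.image fun k => -latticeCross u k).bddAbove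
  obtain ⟨κ₂, hκ₂⟩ := (K.finite_toSet.image fun k => -latticeCross w k).bddAbove
  obtain ⟨z₁, hz₁⟩ := exists_latticeCross_eq_one h.coprime
  set a := latticeCross u d with ha
  set b := latticeCross d w with hb
  let κ := max (max κ₁ κ₂) 0
  have hκ0 : 0 ≤ κ := le_max_right _ _
  have hLpos := h.pos
  have hwd : latticeCross w d = -b := latticeCross_comm w d
  -- `κ` is the margin that translates of `K` need at either side. The summands of `N` pay for the
  -- margin and rounding at the `u`-side, the block of length `L`, and the margin at the `w`-side.
  refine ⟨max (max ρ₁ ρ₂) 1, b * (κ + a) + a * b * L + a * κ,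
    lt_of_lt_of_le one_pos (le_max_right _ _), by positivity, fun M r C hC hM hup => ?_⟩
  -- `q` is the first lattice point on level `r` with `latticeCross u q ≥ κ`; the excess is the
  -- remainder `m % a`.
  let m := r * latticeCross u z₁ - κ
  let q := r • z₁ + (-(m / a)) • d
  have hqu : latticeCross u q = κ + m % a := by
    have := Int.emod_add_mul_ediv m a
    simp only [q, latticeCross_add, latticeCross_smul, ← ha]
    linarith
  have hmod := Int.emod_nonneg m hu.ne'
  have hmod' := Int.emod_lt_of_pos m hu
  have hqd : latticeCross d q = r := by
    simp only [q, latticeCross_add, latticeCross_smul, hz₁, latticeCross_self]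
    ring
  have hqw : 0 ≤ latticeCross w q - b * L + M - κ := by
    have hrel := latticeCross_relation d u w q
    rw [← ha, ← hb, hqu, hqd] at hrel
    refine nonneg_of_mul_nonneg_right (a := a) ?_ hu
    have : b * (m % a) ≤ b * a := by gcongr
    linarith
  refine h.row_subset_of_room (K := K) (ρ := max (max ρ₁ ρ₂) 1) hC ?_ ?_ hK ?_ ?_ hup hqd ?_
  · rintro z ⟨hz1, -⟩ ⟨-, hz2⟩ s hs
    refine ⟨?_, ?_⟩
    · rw [latticeCross_add]; linarith [hSu s hs]
    · have := hSw s hs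
      rw [latticeCross_sub, latticeCross_add] at this
      rw [latticeCross_add] at hz2 ⊢
      rw [latticeCross_sub]
      linarith
  · rintro z ⟨hz1, -⟩ k ⟨-, hz2⟩ j hj hjk
    rw [latticeCross_add, latticeCross_smul, hwd] at hz2
    refine ⟨?_, ?_⟩
    · rw [latticeCross_add, latticeCross_smul, ← ha]
      positivity
    · rw [latticeCross_add, latticeCross_smul, hwd]
      have : b * j ≤ b * k := by gcongr
      linarith
  · intro k hk
    exact ⟨hKpos hk, (hρ₁ (Set.mem_image_of_mem _ hk)).trans
      ((le_max_left _ _).trans (le_max_left _ _))⟩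
  · intro s hs
    exact (hρ₂ (Set.mem_image_of_mem _ hs)).trans ((le_max_right _ _).trans (le_max_left _ _))
  · intro j hj hjL
    have h1 : κ ≤ latticeCross u (q + j • d) := by
      rw [latticeCross_add, latticeCross_smul, ← ha, hqu]
      have : 0 ≤ j * a := by positivity
      linarith
    have h2 : -M + κ ≤ latticeCross w (q + j • d) := by
      rw [latticeCross_add, latticeCross_smul, hwd]
      have : b * j ≤ b * L := by gcongr
      linarith
    refine ⟨⟨by linarith, by linarith⟩, fun k hk => ⟨?_, ?_⟩⟩
    · have h3 : -latticeCross u k ≤ κ := (hκ₁ (Set.mem_image_of_mem _ hk)).trans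
        ((le_max_left _ _).trans (le_max_left _ _))
      rw [latticeCross_add]
      linarith
    · have h3 : -latticeCross w k ≤ κ := (hκ₂ (Set.mem_image_of_mem _ hk)).trans
        ((le_max_right _ _).trans (le_max_left _ _))
      rw [latticeCross_add]
      linarith

/-- Iteration of `EdgeCoding.exists_wedge_row`: a slab of a wedge codes the rows below it as long
as these are long enough. -/
theorem EdgeCoding.exists_wedge_slab [Finite A] [DiscreteTopology A] (h : EdgeCoding X S p d L)
    (hexp : 0 ∈ determined X {z | 0 < latticeCross d z})
    (hu : 0 < latticeCross u d) (hw : 0 < latticeCross d w)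
    (hSu : ∀ s ∈ S, 0 ≤ latticeCross u (s - p))
    (hSw : ∀ s ∈ S, 0 ≤ latticeCross w (s - (p + L • d))) :
    ∃ ρ N : ℤ, 0 < ρ ∧ 0 ≤ N ∧ ∀ (M r T : ℤ) (C : Set (ℤ × ℤ)), determined X C ⊆ C → N ≤ M →
      (∀ s, r ≤ s → s < T → 0 ≤ -(latticeCross w u * s)) →
      (∀ z ∈ wedge u w M, T ≤ latticeCross d z → latticeCross d z < T + ρ → z ∈ C) →
      ∀ z ∈ wedge u w M, r ≤ latticeCross d z → latticeCross d z < T + ρ → z ∈ C := by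
  obtain ⟨ρ, N, hρ, hN, H⟩ := h.exists_wedge_row hexp hu hw hSu hSw
  refine ⟨ρ, N, hρ, hN, fun M r T C hC hM hr htop => ?_⟩
  have hMa : M ≤ latticeCross u d * M := le_mul_of_one_le_left (hN.trans hM) hu
  have key : ∀ n : ℕ, ∀ z ∈ wedge u w M, T - n ≤ latticeCross d z → r ≤ latticeCross d z →
      latticeCross d z < T + ρ → z ∈ C := by
    intro n
    induction n with
    | zero => exact fun z hz h1 _ h2 => htop z hz (by simpa using h1) h2
    | succ n ih =>
      intro z hz h1 h2 h3
      push_cast at h1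
      rcases le_or_gt (T - n) (latticeCross d z) with h4 | h4
      · exact ih z hz h4 h2 h3
      · refine H M (latticeCross d z) C hC ?_ (fun y hy hy1 hy2 => ?_) z hz rfl
        · have := hr _ h2 (by omega)
          linarith
        · exact ih y hy (by omega) (by omega) (by omega)
  intro z hz h1 h2
  exact key (T - latticeCross d z).toNat z hz (by omega) h1 h2

end Rows

/-! ### The four configurations at an expansive edge -/

section Cases

open scoped Pointwise

variable {A : Type*} [TopologicalSpace A] {X : Subshift A (ℤ × ℤ)} {S : Set (ℤ × ℤ)}
  {p d u w : ℤ × ℤ} {L : ℤ}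

theorem exists_le_add_mul {D : Finset (ℤ × ℤ)} (f : ℤ × ℤ → ℤ) (m : ℤ) :
    ∃ k : ℤ, 0 ≤ k ∧ ∀ z ∈ D, ∀ c : ℤ, 0 < c → m ≤ f z + k * c := by
  obtain ⟨B, hB⟩ := (D.finite_toSet.image fun z => m - f z).bddAbove
  refine ⟨max B 0, le_max_right _ _, fun z hz c hc => ?_⟩
  have h1 : m - f z ≤ B := hB (Set.mem_image_of_mem _ hz)
  have h2 : max B 0 ≤ max B 0 * c := le_mul_of_one_le_right (le_max_right _ _) hc
  have h3 := le_max_left B 0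
  linarith

/-- A shift with a coding segment one of whose orientations is expansive is finite. -/
theorem EdgeCoding.finite_of_segment [Finite A] [DiscreteTopology A] (h : EdgeCoding X S p d L)
    (hexp : 0 ∈ determined X {z | 0 < latticeCross d z})
    (hS : ∀ s ∈ S, latticeCross d (s - p) = 0) : X.carrier.Finite := by
  classical
  obtain ⟨K, hKpos, hK⟩ := exists_finite_of_mem_determined hexp
  obtain ⟨ρ₁, hρ₁⟩ := (K.finite_toSet.image (latticeCross d)).bddAbove
  obtain ⟨z₁, hz₁⟩ := exists_latticeCross_eq_one h.coprime
  let ρ := max ρ₁ 0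
  have hρ : 0 ≤ ρ := le_max_right _ _
  -- A parallelogram of `L` points in each of `ρ` rows. As `S` lies on one line, a block of `L`
  -- points codes its row with no help from above.
  let G : Set (ℤ × ℤ) :=
    (fun i : ℤ × ℤ => i.1 • z₁ + i.2 • d) '' (Set.Ico 0 ρ ×ˢ Set.Ico 0 L)
  have hG : G.Finite := ((Set.finite_Ico 0 ρ).prod (Set.finite_Ico 0 L)).image _
  have hC : determined X (determined X G) ⊆ determined X G := determined_subset le_rfl
  have hlev : ∀ i : ℤ, latticeCross d (i • z₁) = i := fun i => by
    rw [latticeCross_smul, hz₁, mul_one]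
  have htop : ∀ z, 0 ≤ latticeCross d z → latticeCross d z < ρ → z ∈ determined X G := by
    intro z hz hzρ
    refine h.row_subset (W := Set.univ) hC (by simp) (by simp) (fun z _ s hs hpos => ?_)
      (hlev (latticeCross d z)) (fun j hj hjL => ⟨trivial, subset_determined _ ?_⟩) z trivial rfl
    · exact absurd (hS s hs) hpos.ne'
    · exact ⟨(latticeCross d z, j), ⟨⟨hz, hzρ⟩, hj, hjL⟩, rfl⟩
  have key : ∀ n : ℕ, ∀ z, -(n : ℤ) ≤ latticeCross d z → latticeCross d z < ρ →
      z ∈ determined X G := by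
    intro n
    induction n with
    | zero => exact fun z h1 h2 => htop z (by simpa using h1) h2
    | succ n ih =>
      intro z h1 h2
      push_cast at h1
      rcases le_or_gt (-(n : ℤ)) (latticeCross d z) with h3 | h3
      · exact ih z h3 h2
      · refine h.row_subset_of_room (W := Set.univ) (ρ := ρ) hC (by simp) (by simp) hK
          (fun k hk => ⟨hKpos hk, (hρ₁ (Set.mem_image_of_mem _ hk)).trans (le_max_left _ _)⟩)
          (fun s hs => (hS s hs).trans_le hρ) (fun y _ hy1 hy2 => ih y ?_ ?_)
          (hlev (latticeCross d z)) (by simp) z trivial rfl <;> omega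
  refine finite_of_determined hG fun D => ?_
  obtain ⟨k, -, hk⟩ := exists_le_add_mul (D := D) (fun z => -latticeCross d z) (1 - ρ)
  refine ⟨(-k) • z₁, fun z hz => key (-(latticeCross d z - k)).toNat _ ?_ ?_⟩
  · rw [latticeCross_add, hlev]
    omega
  · have := hk z hz 1 one_pos
    rw [latticeCross_add, hlev]
    linarith

/-- If the edges adjacent to an expansive edge of a coding polygon diverge on the outside, then the
shift is finite. -/
theorem EdgeCoding.finite_of_diverging [Finite A] [DiscreteTopology A] (h : EdgeCoding X S p d L)
    (hexp : 0 ∈ determined X {z | 0 < latticeCross d z})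
    (hu : 0 < latticeCross u d) (hw : 0 < latticeCross d w)
    (hSu : ∀ s ∈ S, 0 ≤ latticeCross u (s - p))
    (hSw : ∀ s ∈ S, 0 ≤ latticeCross w (s - (p + L • d)))
    (hwu : 0 < latticeCross w u) : X.carrier.Finite := by
  obtain ⟨ρ, N, hρ, hN, H⟩ := h.exists_wedge_slab hexp hu hw hSu hSw
  have hG := finite_wedge_slab hu hw N 0 ρ
  set G := {z ∈ wedge u w N | 0 ≤ latticeCross d z ∧ latticeCross d z < ρ}
  refine finite_of_determined hG fun D => ?_
  obtain ⟨k₁, hk₁0, hk₁⟩ := exists_le_add_mul (D := D) (latticeCross u) 0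
  obtain ⟨k₂, hk₂0, hk₂⟩ := exists_le_add_mul (D := D) (latticeCross w) (-N)
  obtain ⟨k₃, hk₃0, hk₃⟩ := exists_le_add_mul (D := D) (fun z => -latticeCross d z) (1 - ρ)
  have hdu := latticeCross_comm d u
  have huw := latticeCross_comm u w
  have hmono : ∀ {i : ℤ} (c : ℤ), 0 < c → i ≤ k₁ + k₂ + k₃ → i * c ≤ (k₁ + k₂ + k₃) * c :=
    fun c hc hi => by gcongr
  -- Translation by `u - w` moves points into both half planes of the wedge and lowers their level,
  -- so a large multiple brings all of `D` into the coded region.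
  refine ⟨(k₁ + k₂ + k₃) • (u - w), fun z hz => H N (latticeCross d ((k₁ + k₂ + k₃) • (u - w) + z))
    0 (determined X G) (determined_subset le_rfl) le_rfl (fun s _ hs => by nlinarith)
    (fun z hz h1 h2 => subset_determined _ ⟨hz, h1, by linarith⟩) _ ⟨?_, ?_⟩ le_rfl ?_⟩
  · rw [latticeCross_add, latticeCross_smul, latticeCross_sub, latticeCross_self, huw]
    have := hk₁ z hz _ hwu
    have := hmono (i := k₁) _ hwu (by linarith)
    linarith
  · rw [latticeCross_add, latticeCross_smul, latticeCross_sub, latticeCross_self]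
    have := hk₂ z hz _ hwu
    have := hmono (i := k₂) _ hwu (by linarith)
    linarith
  · rw [latticeCross_add, latticeCross_smul, latticeCross_sub, hdu]
    have hab := add_pos hu hw
    have := hk₃ z hz _ hab
    have := hmono (i := k₃) _ hab (by linarith)
    linarith

/-- If the edges adjacent to an expansive edge of a coding polygon are parallel, then a segment
parallel to them codes a recoding. -/
theorem EdgeCoding.exists_translation [Finite A] [DiscreteTopology A] (h : EdgeCoding X S p d L)
    (hexp : 0 ∈ determined X {z | 0 < latticeCross d z})
    (hu : 0 < latticeCross u d) (hw : 0 < latticeCross d w)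
    (hSu : ∀ s ∈ S, 0 ≤ latticeCross u (s - p))
    (hSw : ∀ s ∈ S, 0 ≤ latticeCross w (s - (p + L • d)))
    (hwu : latticeCross w u = 0) :
    ∃ G : Finset (ℤ × ℤ), G.Nonempty ∧ (∀ g ∈ G, u + g ∈ determined X (G : Set (ℤ × ℤ))) ∧
      (G : Set (ℤ × ℤ)) ⊆ determined X ((u + ·) '' (G : Set (ℤ × ℤ))) := by
  obtain ⟨ρ, N, hρ, hN, H⟩ := h.exists_wedge_slab hexp hu hw hSu hSw
  have hG := finite_wedge_slab hu hw N 0 ρ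
  set G := {z ∈ wedge u w N | 0 ≤ latticeCross d z ∧ latticeCross d z < ρ} with hGdef
  have hdu := latticeCross_comm d u
  -- Since `u` is parallel to both sides, translation by `u` keeps the wedge conditions and only
  -- lowers the level.
  have hcode : ∀ g ∈ G, u + g ∈ determined X G := fun g hg => by
    refine H N (latticeCross d (u + g)) 0 (determined X G) (determined_subset le_rfl) le_rfl
      (fun s _ hs => by simp [hwu]) (fun z hz h1 h2 => subset_determined _ ⟨hz, h1, by linarith⟩) _
      ⟨?_, ?_⟩ le_rfl ?_
    · rw [latticeCross_add, latticeCross_self]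
      linarith [hg.1.1]
    · rw [latticeCross_add, hwu]
      linarith [hg.1.2]
    · rw [latticeCross_add, hdu]
      linarith [hg.2.2]
  refine ⟨hG.toFinset, ⟨0, ?_⟩, ?_, ?_⟩
  · rw [Set.Finite.mem_toFinset]
    exact ⟨⟨(latticeCross_zero _).ge, by rw [latticeCross_zero]; linarith⟩,
      (latticeCross_zero _).ge, by rwa [latticeCross_zero]⟩
  · simpa using hcode
  · simpa using subset_determined_add hG u hcode

/-- If the edges adjacent to an expansive edge of a coding polygon converge on the outside, then
after a recoding the apex where they meet is coded by points on the adjacent edges. -/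
theorem EdgeCoding.exists_apex [Finite A] [DiscreteTopology A] (h : EdgeCoding X S p d L)
    (hexp : 0 ∈ determined X {z | 0 < latticeCross d z})
    (hu : 0 < latticeCross u d) (hw : 0 < latticeCross d w)
    (hSu : ∀ s ∈ S, 0 ≤ latticeCross u (s - p))
    (hSw : ∀ s ∈ S, 0 ≤ latticeCross w (s - (p + L • d)))
    (hwu : latticeCross w u < 0) :
    ∃ (G : Finset (ℤ × ℤ)) (J : ℤ), G.Nonempty ∧ 0 < J ∧ ∀ T : Set (ℤ × ℤ),
      (∀ j, 0 < j → j ≤ J → (-j) • u ∈ T ∧ j • w ∈ T) →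
      (G : Set (ℤ × ℤ)) ⊆ determined X (T + (G : Set (ℤ × ℤ))) := by
  obtain ⟨ρ, N, hρ, hN, H⟩ := h.exists_wedge_slab hexp hu hw hSu hSw
  have hdu := latticeCross_comm d u
  have huw := latticeCross_comm u w
  set a := latticeCross u d with ha
  set b := latticeCross d w with hb
  set c := latticeCross w u with hc
  -- `J` bounds the levels to be covered, hence the number of steps. `M` makes the wedge so wide
  -- that on these levels a point is at least `J * -c` away from one of the two sides, so it can be
  -- moved down parallel to the other side without leaving the wedge.
  let J := a + b + ρ
  let M := N + J * -c * (1 + b)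
  have hJ : 0 < J := by positivity
  have hc' : 0 < -c := neg_pos.2 hwu
  have hJc : 0 < J * -c := by positivity
  have hNM : N ≤ M := le_add_of_nonneg_right (by positivity)
  have hG := finite_wedge_slab hu hw M 0 (a + b)
  set G := {z ∈ wedge u w M | 0 ≤ latticeCross d z ∧ latticeCross d z < a + b} with hGdef
  refine ⟨hG.toFinset, J, ⟨0, ?_⟩, hJ, fun T hT => ?_⟩
  · rw [Set.Finite.mem_toFinset]
    exact ⟨⟨(latticeCross_zero _).ge, by rw [latticeCross_zero]; linarith⟩,
      (latticeCross_zero _).ge, by rw [latticeCross_zero]; positivity⟩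
  rw [Set.Finite.coe_toFinset]
  intro z hz
  refine H M 0 (a + b) _ (determined_subset le_rfl) hNM (fun s hs _ => by nlinarith) ?_ z hz.1
    hz.2.1 (by linarith [hz.2.2])
  rintro z ⟨hzu, hzw⟩ hzT hzT'
  refine subset_determined _ ?_
  -- A point of the slab above `G` drops into `G` after `latticeCross d z / m` steps that lower the
  -- level by `m`; here `m` is `a` for steps `u` and `b` for steps `-w`.
  have bound : ∀ m : ℤ, 0 < m → m ≤ a + b → 0 < latticeCross d z / m ∧
      latticeCross d z / m ≤ J ∧ 0 ≤ latticeCross d z - latticeCross d z / m * m ∧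
      latticeCross d z - latticeCross d z / m * m < a + b := by
    intro m hm hmab
    have h1 := Int.emod_nonneg (latticeCross d z) hm.ne'
    have h2 := Int.emod_lt_of_pos (latticeCross d z) hm
    have h3 := Int.emod_add_mul_ediv (latticeCross d z) m
    refine ⟨Int.le_ediv_of_mul_le hm (by linarith), ?_, by linarith, by linarith⟩
    exact (Int.ediv_le_self _ (by linarith)).trans hzT'.le
  rcases le_or_gt (-M + J * -c) (latticeCross w z) with hcase | hcase
  · obtain ⟨hj0, hjJ, hlo, hhi⟩ := bound a hu (by linarith)
    set j := latticeCross d z / a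
    refine ⟨(-j) • u, (hT j hj0 hjJ).1, z + j • u, ⟨⟨?_, ?_⟩, ?_, ?_⟩, by module⟩
    · rw [latticeCross_add, latticeCross_smul, latticeCross_self]
      linarith
    · rw [latticeCross_add, latticeCross_smul, ← hc]
      have : j * -c ≤ J * -c := by gcongr
      linarith
    · rw [latticeCross_add, latticeCross_smul, hdu]
      linarith
    · rw [latticeCross_add, latticeCross_smul, hdu]
      linarith
  · obtain ⟨hj0, hjJ, hlo, hhi⟩ := bound b hw (by linarith)
    set j := latticeCross d z / b
    refine ⟨j • w, (hT j hj0 hjJ).2, z - j • w, ⟨⟨?_, ?_⟩, ?_, ?_⟩, by simp⟩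
    · have hrel := latticeCross_relation d u w z
      rw [← ha, ← hb, ← hc] at hrel
      have h1 : J * -c * b ≤ -latticeCross w z := by
        have : M = N + J * -c + J * -c * b := by ring
        linarith
      have h2 : -latticeCross w z ≤ a * -latticeCross w z :=
        le_mul_of_one_le_left (le_trans (by positivity) h1) hu
      have h3 : 0 ≤ -c * latticeCross d z := mul_nonneg hc'.le (by linarith)
      have h4 : b * (J * -c) ≤ b * latticeCross u z := by linarith
      have h5 := le_of_mul_le_mul_left h4 hw
      have h6 : j * -c ≤ J * -c := by gcongr
      rw [latticeCross_sub, latticeCross_smul, huw]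
      linarith
    · rw [latticeCross_sub, latticeCross_smul, latticeCross_self]
      linarith
    · rw [latticeCross_sub, latticeCross_smul, ← hb]
      linarith
    · rw [latticeCross_sub, latticeCross_smul, ← hb]
      linarith

end Cases

theorem latticePt_add (z w : ℤ × ℤ) : latticePt (z + w) = latticePt z + latticePt w := by
  simp [latticePt]

theorem latticePt_sub (z w : ℤ × ℤ) : latticePt (z - w) = latticePt z - latticePt w := by
  simp [latticePt]

theorem latticePt_smul (k : ℤ) (z : ℤ × ℤ) : latticePt (k • z) = (k : ℝ) • latticePt z := by
  simp [latticePt]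

theorem latticePt_ne_zero {z : ℤ × ℤ} (hz : z ≠ 0) : latticePt z ≠ 0 := fun h =>
  hz (latticePt_injective (h.trans (by ext <;> simp [latticePt])))

theorem preimage_diff_latticePt (P : Set (ℝ × ℝ)) (z : ℤ × ℤ) :
    latticePt ⁻¹' (P \ {latticePt z}) = latticePt ⁻¹' P \ {z} := by
  ext s
  simp [latticePt_injective.eq_iff]

/-! ### Removing a side of a coding polygon with an expansive edge -/

section Polygon

open scoped Pointwise

variable {A : Type*} [TopologicalSpace A] {X : Subshift A (ℤ × ℤ)} {P : Set (ℝ × ℝ)}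

theorem IsCodingPolygon.mem_determined (hP : IsCodingPolygon X P) {z : ℤ × ℤ}
    (hz : latticePt z ∈ polygonVertices P) : z ∈ determined X (latticePt ⁻¹' P \ {z}) := by
  rw [← preimage_diff_latticePt]
  exact codes_iff.1 (hP.2 _ hz) rfl

theorem exists_primitive {z : ℤ × ℤ} (hz : z ≠ 0) :
    ∃ (d : ℤ × ℤ) (L : ℤ), IsCoprime d.1 d.2 ∧ 0 < L ∧ z = L • d := by
  have hpos : 0 < Int.gcd z.1 z.2 := by
    rw [Nat.pos_iff_ne_zero, Ne, Int.gcd_eq_zero_iff]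
    exact fun h => hz (Prod.ext h.1 h.2)
  obtain ⟨m, n, hmn, h1, h2⟩ := Int.exists_gcd_one hpos
  refine ⟨(m, n), Int.gcd z.1 z.2, Int.isCoprime_iff_gcd_eq_one.2 hmn, by exact_mod_cast hpos, ?_⟩
  ext
  · simpa [mul_comm] using h1
  · simpa [mul_comm] using h2

/-- Passage from real to integer geometry: `L` is the lattice length of the edge, and extremality of
its endpoints confines the lattice points of `P` on its line to the edge itself. -/
theorem IsCodingPolygon.exists_edgeCoding (hP : IsCodingPolygon X P) {e₁ e₂ : ℝ × ℝ}
    (he : (e₁, e₂) ∈ orientedEdges P) : ∃ (p d : ℤ × ℤ) (L : ℤ), latticePt p = e₁ ∧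
      latticePt (p + L • d) = e₂ ∧ EdgeCoding X (latticePt ⁻¹' P) p d L := by
  obtain ⟨p, rfl⟩ := hP.1.exists_latticePt_eq he.1
  obtain ⟨q, rfl⟩ := hP.1.exists_latticePt_eq he.2.1
  have hpq : q - p ≠ 0 := fun h => he.2.2.1 (congrArg latticePt (sub_eq_zero.1 h).symm)
  obtain ⟨d, L, hd, hL, hqp⟩ := exists_primitive hpq
  obtain rfl : q = p + L • d := by rw [← hqp]; abel
  have hLR : (0 : ℝ) < L := by exact_mod_cast hL
  have hcross : ∀ s, cross (latticePt (p + L • d) - latticePt p) (latticePt s - latticePt p) =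
      L * (latticeCross d (s - p) : ℝ) := fun s => by
    rw [← latticePt_sub, ← latticePt_sub, add_sub_cancel_left, latticePt_smul, cross_smul_left,
      cross_latticePt]
  refine ⟨p, d, L, rfl, rfl, hd, hP.1.finite_latticePts, hL, fun s hs => ?_, fun s hs h => ?_,
    hP.mem_determined he.1, hP.mem_determined he.2.1⟩
  · have h1 := he.2.2.2 _ hs
    change 0 ≤ cross (latticePt (p + L • d) - latticePt p) (latticePt s - latticePt p) at h1
    rw [hcross] at h1
    exact_mod_cast nonneg_of_mul_nonneg_right h1 hLR
  · obtain ⟨j, hj⟩ := exists_eq_smul_of_latticeCross_eq_zero hd h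
    obtain ⟨t, ht0, ht1, hst⟩ := exists_smul_of_mem_edge_line he hs (by rw [hcross, h]; simp)
    have hd0 : latticePt d ≠ 0 := latticePt_ne_zero fun h => by
      subst h
      simp at hqp
      exact hpq (by simp)
    have h1 : latticePt s - latticePt p = (j : ℝ) • latticePt d := by
      rw [← latticePt_sub, hj, latticePt_smul]
    have h2 : latticePt s - latticePt p = (t * L) • latticePt d := by
      rw [hst, add_sub_cancel_left, ← latticePt_sub, add_sub_cancel_left, latticePt_smul, smul_smul]
    have h3 : (j : ℝ) = t * L := smul_left_injective ℝ hd0 (h1.symm.trans h2)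
    refine ⟨j, ?_, ?_, by rw [← hj]; abel⟩
    · have : (0 : ℝ) ≤ j := by rw [h3]; positivity
      exact_mod_cast this
    · have : (j : ℝ) ≤ L := by rw [h3]; exact mul_le_of_le_one_left hLR.le ht1
      exact_mod_cast this

theorem latticeCross_nonneg_of_edge {p q : ℤ × ℤ} (he : (latticePt p, latticePt q) ∈ orientedEdges P)
    {s : ℤ × ℤ} (hs : latticePt s ∈ P) : 0 ≤ latticeCross (q - p) (s - p) := by
  have := he.2.2.2 _ hs
  change 0 ≤ cross (latticePt q - latticePt p) (latticePt s - latticePt p) at this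
  rw [← latticePt_sub, ← latticePt_sub, cross_latticePt] at this
  exact_mod_cast this

theorem latticeCross_consecutive_pos {p q r s : ℤ × ℤ}
    (h : (latticePt p, latticePt q) ∈ orientedEdges P)
    (h' : (latticePt q, latticePt r) ∈ orientedEdges P) (hs : latticePt s ∈ P)
    (hpos : 0 < latticeCross (q - p) (s - p) ∨ 0 < latticeCross (r - q) (s - q)) :
    0 < latticeCross (q - p) (r - q) := by
  have := cross_consecutive_pos h h' hs (by
    simp only [← latticePt_sub, cross_latticePt]
    exact_mod_cast hpos)
  rw [← latticePt_sub, ← latticePt_sub, cross_latticePt] at this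
  exact_mod_cast this

/-- The segment from `0` to `u` is coding for the recoding by the patterns on translates of `G`
if `G` and `u + G` code each other. -/
theorem exists_segment_of_translation {u : ℤ × ℤ} (hu : u ≠ 0) {G : Finset (ℤ × ℤ)}
    (h1 : ∀ g ∈ G, u + g ∈ determined X (G : Set (ℤ × ℤ)))
    (h2 : (G : Set (ℤ × ℤ)) ⊆ determined X ((u + ·) '' (G : Set (ℤ × ℤ)))) :
    ∃ Q, IsConvexIntegerPolygon Q ∧ (∀ v : ℤ × ℤ, latticePt v ∈ polygonVertices Q → ∀ g ∈ G,
      v + g ∈ determined X (latticePt ⁻¹' (Q \ {latticePt v}) + (G : Set (ℤ × ℤ)))) ∧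
      numSides Q ≤ 2 := by
  let V : Finset (ℤ × ℤ) := {0, u}
  let Q := convexHull ℝ (latticePt '' (V : Set (ℤ × ℤ)))
  have hQ : IsConvexIntegerPolygon Q :=
    ⟨V, ⟨0, by simp [V], u, by simp [V], hu.symm⟩, rfl⟩
  have hmem : ∀ z ∈ V, latticePt z ∈ Q := fun z hz => subset_convexHull ℝ _ ⟨z, hz, rfl⟩
  have hvert : ∀ v : ℤ × ℤ, latticePt v ∈ polygonVertices Q → v = 0 ∨ v = u := fun v hv => by
    obtain ⟨z, hz, hzv⟩ := mem_of_mem_polygonVertices hv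
    rw [← latticePt_injective hzv]
    simpa [V] using hz
  refine ⟨Q, hQ, fun v hv g hg => ?_, ?_⟩
  · rw [preimage_diff_latticePt]
    rcases hvert v hv with rfl | rfl
    · rw [zero_add]
      refine determined_mono ?_ (h2 hg)
      rintro _ ⟨g, hg, rfl⟩
      exact Set.add_mem_add ⟨hmem u (by simp [V]), hu⟩ hg
    · refine determined_mono (fun g hg => ?_) (h1 g hg)
      rw [← zero_add g]
      exact Set.add_mem_add ⟨hmem 0 (by simp [V]), hu.symm⟩ hg
  · rw [hQ.numSides_eq]
    have : polygonVertices Q ⊆ {latticePt 0, latticePt u} := fun v hv => by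
      obtain ⟨z, rfl⟩ := hQ.exists_latticePt_eq hv
      rcases hvert z hv with rfl | rfl <;> simp
    exact (Set.encard_le_encard this).trans ((Set.encard_insert_le _ _).trans
      (by rw [Set.encard_singleton]; norm_num))

/-- Cutting a corner backwards: if the edges adjacent to the edge `(p, q)` of a coding polygon
meet on the outside, there is a polygon with fewer sides, obtained from a multiple of the given one
by adding their intersection, all of whose vertices other than the new one are coded. -/
theorem IsCodingPolygon.exists_cone (hP : IsCodingPolygon X P) {p q o r d : ℤ × ℤ} {L : ℤ}
    (hL : 0 < L) (hq : q = p + L • d) (he : (latticePt p, latticePt q) ∈ orientedEdges P)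
    (hpo : latticePt o ∈ P) (hpr : latticePt r ∈ P)
    (ha : 0 < latticeCross (p - o) d) (hb : 0 < latticeCross d (r - q))
    (hc : latticeCross (r - q) (p - o) < 0) {J : ℤ} (hJ : 0 < J) {G : Finset (ℤ × ℤ)}
    (hG : ∀ T : Set (ℤ × ℤ), (∀ j, 0 < j → j ≤ J → (-j) • (p - o) ∈ T ∧ j • (r - q) ∈ T) →
      (G : Set (ℤ × ℤ)) ⊆ determined X (T + (G : Set (ℤ × ℤ)))) :
    ∃ Q, IsConvexIntegerPolygon Q ∧ (∀ v : ℤ × ℤ, latticePt v ∈ polygonVertices Q → ∀ g ∈ G,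
      v + g ∈ determined X (latticePt ⁻¹' (Q \ {latticePt v}) + (G : Set (ℤ × ℤ)))) ∧
      numSides Q < numSides P := by
  classical
  obtain ⟨V, hV, hPV⟩ := hP.1
  set u := p - o with hu
  set w := r - q with hw
  have hu0 : u ≠ 0 := by
    intro h
    rw [h] at ha
    simp [latticeCross] at ha
  have hw0 : w ≠ 0 := by
    intro h
    rw [h, latticeCross_zero] at hb
    exact lt_irrefl _ hb
  set a := latticeCross u d with ha'
  set b := latticeCross d w with hb'
  set c := latticeCross w u with hc'
  have hc0 : 0 < -c := neg_pos.2 hc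
  have hrel : (-c) • d = a • w + b • u := by
    ext <;>
      simp only [a, b, c, latticeCross, Prod.fst_add, Prod.snd_add, Prod.smul_fst, Prod.smul_snd,
        smul_eq_mul] <;> ring
  let N := -c * J
  have hN : 0 < N := by positivity
  have hNR : (0 : ℝ) < N := by exact_mod_cast hN
  -- The point where the extended adjacent sides of `N • P` meet. The factor `-c` in `N` makes it a
  -- lattice point, and the factor `J` leaves room for `J` steps `-u` and `J` steps `w` from it
  -- along the sides of `Q`.
  let α := N • p + (J * L * b) • u
  have hα : α = N • q - (J * L * a) • w := by
    have : N • q = N • p + (J * L) • ((-c) • d) := by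
      rw [hq]
      simp only [N]
      module
    rw [this, hrel]
    simp only [α]
    module
  let V' := insert α (V.image (N • ·))
  let Q := convexHull ℝ (latticePt '' (V' : Set (ℤ × ℤ)))
  have hsmul : Function.Injective fun z : ℤ × ℤ => N • z := smul_right_injective _ hN.ne'
  have hQ : IsConvexIntegerPolygon Q := by
    obtain ⟨x, hx, y, hy, hxy⟩ := hV
    exact ⟨V', ⟨N • x, Finset.mem_insert_of_mem (Finset.mem_image_of_mem _ hx), N • y,
      Finset.mem_insert_of_mem (Finset.mem_image_of_mem _ hy), hsmul.ne hxy⟩, rfl⟩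
  have hαQ : latticePt α ∈ Q := subset_convexHull ℝ _ ⟨α, by simp [V'], rfl⟩
  have hNQ : ∀ x ∈ P, (N : ℝ) • x ∈ Q := by
    intro x hx
    rw [hPV] at hx
    refine convexHull_min (t := {x | (N : ℝ) • x ∈ Q}) ?_ ?_ hx
    · rintro _ ⟨z, hz, rfl⟩
      refine subset_convexHull ℝ _ ⟨N • z, ?_, latticePt_smul N z⟩
      simp only [V', Finset.coe_insert, Finset.coe_image]
      exact Or.inr ⟨z, hz, rfl⟩
    · exact (convex_convexHull ℝ _).is_linear_preimage ⟨smul_add _, fun s x => smul_comm _ _ _⟩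
  have hNQz : ∀ z, latticePt z ∈ P → latticePt (N • z) ∈ Q := fun z hz => by
    rw [latticePt_smul]
    exact hNQ _ hz
  have hseg : ∀ x y : ℝ × ℝ, ∀ k : ℤ, x ∈ Q → x + (k : ℝ) • y ∈ Q → ∀ j : ℤ, 0 ≤ j → j ≤ k →
      x + (j : ℝ) • y ∈ Q := by
    intro x y k hx hy j hj hjk
    have hj' : (0 : ℝ) ≤ j := by exact_mod_cast hj
    have hjk' : (j : ℝ) ≤ k := by exact_mod_cast hjk
    rcases hj'.eq_or_lt with h0 | h0
    · rw [← h0]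
      simpa using hx
    have hk : (0 : ℝ) < k := h0.trans_le hjk'
    have := hQ.convex.add_smul_mem hx hy (t := j / k) ⟨by positivity, (div_le_one hk).2 hjk'⟩
    rwa [smul_smul, div_mul_cancel₀ _ hk.ne'] at this
  have hp : latticePt p ∈ P := he.1.1
  have hqP : latticePt q ∈ P := he.2.1.1
  have hvert : ∀ v : ℤ × ℤ, latticePt v ∈ polygonVertices Q → v = α ∨
      ∃ z, v = N • z ∧ latticePt z ∈ polygonVertices P ∧ z ≠ p ∧ z ≠ q := by
    intro v hv
    obtain ⟨z, hz, hzv⟩ := mem_of_mem_polygonVertices hv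
    obtain rfl := latticePt_injective hzv
    rw [Finset.mem_coe, Finset.mem_insert, Finset.mem_image] at hz
    rcases hz with rfl | ⟨z, hz, rfl⟩
    · exact Or.inl rfl
    refine Or.inr ⟨z, rfl, ?_, ?_, ?_⟩
    · rw [polygonVertices, mem_extremePoints_iff_left]
      refine ⟨hPV ▸ subset_convexHull ℝ _ ⟨z, hz, rfl⟩, fun x hx y hy hxy => ?_⟩
      obtain ⟨s, t, hs, ht, hst, hsum⟩ := hxy
      have := (mem_extremePoints_iff_left.1 hv).2 _ (hNQ x hx) _ (hNQ y hy)
        ⟨s, t, hs, ht, hst, by rw [latticePt_smul, ← hsum]; module⟩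
      rw [latticePt_smul] at this
      exact smul_right_injective _ hNR.ne' this
    · rintro rfl
      -- `N • p` lies strictly between `N • o` and `α`, so it is no longer extreme; likewise `N • q`
      -- between `α` and `N • r`.
      refine not_both_sides hv (latticePt_ne_zero hu0) (s := ((J * L * b : ℤ) : ℝ)) (t := N)
        (by exact_mod_cast (by positivity : 0 < J * L * b)) hNR ?_ ?_
      · rwa [← latticePt_smul, ← latticePt_add]
      · rw [← Int.cast_neg, ← latticePt_smul, ← latticePt_add]
        convert hNQz o hpo using 2
        rw [hu]
        module
    · rintro rfl
      refine not_both_sides hv (latticePt_ne_zero hw0) (t := ((J * L * a : ℤ) : ℝ)) (s := N)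
        hNR (by exact_mod_cast (by positivity : 0 < J * L * a)) ?_ ?_
      · rw [← latticePt_smul, ← latticePt_add]
        convert hNQz r hpr using 2
        rw [hw]
        module
      · rw [← Int.cast_neg, ← latticePt_smul, ← latticePt_add]
        convert hαQ using 2
        rw [hα]
        module
  refine ⟨Q, hQ, fun v hv g hg => ?_, ?_⟩
  · rw [preimage_diff_latticePt]
    rcases hvert v hv with rfl | ⟨z, rfl, hz, -, -⟩
    · have := hG ((fun x => x - α) '' (latticePt ⁻¹' Q \ {α})) (fun j hj hjJ => ⟨?_, ?_⟩) hg
      · refine add_mem_determined α this ?_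
        rintro _ ⟨_, ⟨y, hy, rfl⟩, g, hg, rfl⟩
        refine subset_determined _ ⟨y, hy, g, hg, ?_⟩
        simp only
        abel
      · refine ⟨α + (-j) • u, ⟨?_, ?_⟩, by simp⟩
        · have := hseg (latticePt α) (-latticePt u) (J * L * b) hαQ (by
            convert hNQz p hp using 1
            simp only [α, latticePt_add, latticePt_smul]
            module) j hj.le (hjJ.trans ?_)
          · rw [Set.mem_preimage, latticePt_add, latticePt_smul]
            convert this using 1
            push_cast
            module
          · rw [mul_assoc]
            exact le_mul_of_one_le_right hJ.le (by positivity : 0 < L * b)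
        · rw [Set.mem_singleton_iff, add_eq_left, smul_eq_zero]
          exact fun h => h.elim (by omega) hu0
      · refine ⟨α + j • w, ⟨?_, ?_⟩, by simp⟩
        · have := hseg (latticePt α) (latticePt w) (J * L * a) hαQ (by
            convert hNQz q hqP using 1
            rw [hα]
            simp only [latticePt_sub, latticePt_smul]
            module) j hj.le (hjJ.trans ?_)
          · rwa [Set.mem_preimage, latticePt_add, latticePt_smul]
          · rw [mul_assoc]
            exact le_mul_of_one_le_right hJ.le (by positivity : 0 < L * a)
        · rw [Set.mem_singleton_iff, add_eq_left, smul_eq_zero]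
          exact fun h => h.elim (by omega) hw0
    -- At an old vertex the original polygon still codes: by convexity `(N - 1) • z + P` lies in `N
    -- • P`, and its vertex `(N - 1) • z + z` is `N • z`.
    · have := add_mem_determined (T := latticePt ⁻¹' Q \ {N • z} + (G : Set (ℤ × ℤ)))
        ((N - 1) • z + g) (hP.mem_determined hz) ?_
      · convert this using 1
        module
      · rintro s ⟨hs, hsz⟩
        refine subset_determined _ ⟨(N - 1) • z + s, ⟨?_, ?_⟩, g, hg, by simp only; abel⟩
        · have h1 := hseg (latticePt (N • z)) (latticePt s - latticePt z) N
            (hNQz z hz.1) (by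
              convert hNQz s hs using 1
              simp only [latticePt_smul]
              module) 1 zero_le_one hN
          rw [Set.mem_preimage]
          convert h1 using 1
          simp only [latticePt_add, latticePt_smul]
          push_cast
          module
        · intro h
          refine hsz ?_
          have h' : (N - 1) • z + s = N • z := h
          have : s = N • z - (N - 1) • z := by rw [← h']; abel
          rw [Set.mem_singleton_iff, this]
          module
  · rw [hQ.numSides_eq, hP.1.numSides_eq]
    set E := polygonVertices P \ {latticePt p, latticePt q} with hE
    have hsub : polygonVertices Q ⊆ insert (latticePt α) (((N : ℝ) • ·) '' E) := by
      intro v hv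
      obtain ⟨z, rfl⟩ := hQ.exists_latticePt_eq hv
      rcases hvert z hv with rfl | ⟨z, rfl, hz, hzp, hzq⟩
      · exact Or.inl rfl
      · exact Or.inr ⟨latticePt z, ⟨hz, by simp [latticePt_injective.eq_iff, hzp, hzq]⟩,
          (latticePt_smul N z).symm⟩
    have hEfin : E.encard ≠ ⊤ :=
      Set.encard_ne_top_iff.2 (hP.1.finite_vertices.subset Set.sdiff_subset)
    have h2 : E.encard + 2 = (polygonVertices P).encard := by
      rw [← Set.encard_sdiff_add_encard_of_subset
        (Set.insert_subset he.1 (Set.singleton_subset_iff.2 he.2.1)), Set.encard_pair he.2.2.1]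
    calc (polygonVertices Q).encard ≤ (insert (latticePt α) (((N : ℝ) • ·) '' E)).encard :=
          Set.encard_le_encard hsub
      _ ≤ E.encard + 1 := (Set.encard_insert_le _ _).trans
          (add_le_add_left (Set.encard_image_le _ _) 1)
      _ < E.encard + 2 := by
          rw [ENat.add_lt_add_iff_left hEfin]
          norm_num
      _ = _ := h2

/-- If an edge of a coding polygon has an expansive direction, then some recoding has a coding
polygon with fewer sides. -/
theorem IsCodingPolygon.exists_fewer_sides [Finite A] [DiscreteTopology A]
    (hX : X.carrier.Infinite) (hP : IsCodingPolygon X P) {p d : ℤ × ℤ} {L : ℤ}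
    (he : (latticePt p, latticePt (p + L • d)) ∈ orientedEdges P)
    (h : EdgeCoding X (latticePt ⁻¹' P) p d L)
    (hexp : 0 ∈ determined X {z | 0 < latticeCross d z}) :
    ∃ (G : Finset (ℤ × ℤ)) (Q : Set (ℝ × ℝ)), G.Nonempty ∧ IsConvexIntegerPolygon Q ∧
      (∀ v : ℤ × ℤ, latticePt v ∈ polygonVertices Q → ∀ g ∈ G,
        v + g ∈ determined X (latticePt ⁻¹' (Q \ {latticePt v}) + (G : Set (ℤ × ℤ)))) ∧
      numSides Q < numSides P := by
  set q := p + L • d with hq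
  obtain ⟨o', ho⟩ := hP.1.exists_prev he.1
  obtain ⟨o, rfl⟩ := hP.1.exists_latticePt_eq ho.1
  obtain ⟨r', hr⟩ := hP.1.exists_next he.2.1
  obtain ⟨r, rfl⟩ := hP.1.exists_latticePt_eq hr.2.1
  -- Infinitude rules out a degenerate polygon; a point off the edge line then makes both corners of
  -- the edge strict.
  obtain ⟨s, hs, hspos⟩ : ∃ s, latticePt s ∈ P ∧ 0 < latticeCross d (s - p) := by
    by_contra! hall
    exact hX (h.finite_of_segment hexp fun s hs => le_antisymm (hall s hs) (h.left s hs))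
  have hqp : q - p = L • d := by rw [hq]; abel
  have hleft : ∀ z, latticeCross (L • d) z = L * latticeCross d z := fun z => by
    simp only [latticeCross, Prod.smul_fst, Prod.smul_snd, smul_eq_mul]; ring
  have hspos' : 0 < latticeCross (q - p) (s - p) := by
    rw [hqp, hleft]
    exact mul_pos h.pos hspos
  have hu : 0 < latticeCross (p - o) d := by
    have := latticeCross_consecutive_pos ho he hs (Or.inr hspos')
    rw [hqp, latticeCross_smul] at this
    exact pos_of_mul_pos_right this h.pos.le
  have hw : 0 < latticeCross d (r - q) := by
    have := latticeCross_consecutive_pos he hr hs (Or.inl hspos')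
    rw [hqp, hleft] at this
    exact pos_of_mul_pos_right this h.pos.le
  have hSu : ∀ s ∈ latticePt ⁻¹' P, 0 ≤ latticeCross (p - o) (s - p) := fun s hs => by
    have := latticeCross_nonneg_of_edge ho hs
    rw [show s - o = s - p + (p - o) by abel, latticeCross_add, latticeCross_self] at this
    linarith
  have hSw : ∀ s ∈ latticePt ⁻¹' P, 0 ≤ latticeCross (r - q) (s - q) := fun s hs =>
    latticeCross_nonneg_of_edge hr hs
  rcases lt_trichotomy (latticeCross (r - q) (p - o)) 0 with hc | hc | hc
  · obtain ⟨G, J, hG, hJ, hcode⟩ := h.exists_apex hexp hu hw hSu hSw hc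
    obtain ⟨Q, hQ⟩ := hP.exists_cone h.pos hq he ho.1.1 hr.2.1.1 hu hw hc hJ hcode
    exact ⟨G, Q, hG, hQ⟩
  · obtain ⟨G, hG, h1, h2⟩ := h.exists_translation hexp hu hw hSu hSw hc
    have hu0 : p - o ≠ 0 := fun h => by
      rw [h] at hu
      simp [latticeCross] at hu
    obtain ⟨Q, hQ, hQcode, hQsides⟩ := exists_segment_of_translation hu0 h1 h2
    refine ⟨G, Q, hG, hQ, hQcode, hQsides.trans_lt ?_⟩
    have hrp : r ≠ p := by
      rintro rfl
      rw [show r - q = (-L) • d by rw [hq]; module, latticeCross_smul, latticeCross_self] at hw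
      simp at hw
    have hsub : {latticePt r, latticePt p, latticePt q} ⊆ polygonVertices P := by
      rintro _ (rfl | rfl | rfl)
      exacts [hr.2.1, he.1, he.2.1]
    rw [hP.1.numSides_eq]
    refine lt_of_lt_of_le ?_ (Set.encard_le_encard hsub)
    have hpq : latticePt p ≠ latticePt q := he.2.2.1
    have hqr : latticePt q ≠ latticePt r := hr.2.2.1
    rw [Set.encard_insert_of_notMem, Set.encard_pair hpq]
    · norm_num
    · rintro (h | h)
      · exact hrp (latticePt_injective h)
      · exact hqr h.symm
  · exact (hX (h.finite_of_diverging hexp hu hw hSu hSw hc)).elim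

end Polygon

/-! ### Expansive directions and closing blocks -/

section HalfPlanes

open scoped Pointwise

variable {A : Type*} [TopologicalSpace A] {X : Subshift A (ℤ × ℤ)} {P : Set (ℝ × ℝ)}

theorem isExpansiveRay_iff {v : ℝ × ℝ} : IsExpansiveRay X v ↔
    ∃ c : ℝ, ∀ z, z ∈ determined X {y | c ≤ cross v (latticePt y)} := by
  constructor
  · rintro ⟨c, h | h⟩
    · exact ⟨c, fun z => codes_iff.1 h trivial⟩
    · exact ⟨c, fun z => determined_mono (S := latticePt ⁻¹' openHalfPlane v c)
        (fun y (hy : c < cross v (latticePt y)) => hy.le) (codes_iff.1 h trivial)⟩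
  · rintro ⟨c, h⟩
    exact ⟨c, Or.inl (codes_iff.2 fun z _ => h z)⟩

theorem IsRecodingVia.isExpansiveRay_iff {B : Type*} [TopologicalSpace B]
    {Y : Subshift B (ℤ × ℤ)} {F : Finset (ℤ × ℤ)} (h : IsRecodingVia X F Y) (hF : F.Nonempty)
    {v : ℝ × ℝ} : IsExpansiveRay Y v ↔ IsExpansiveRay X v := by
  rw [_root_.isExpansiveRay_iff, _root_.isExpansiveRay_iff]
  constructor
  -- The lowest element `f₀` of `F` bounds from below the sites of `X` seen from a half plane of
  -- `Y`. For the converse any `f₀` works, since shifting by it covers the half plane.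
  · rintro ⟨c, hc⟩
    obtain ⟨f₀, hf₀, hmin⟩ := F.exists_min_image (fun f => cross v (latticePt f)) hF
    refine ⟨c + cross v (latticePt f₀), fun z => ?_⟩
    have := h.mem_determined_iff.1 (hc (z - f₀)) f₀ hf₀
    rw [sub_add_cancel] at this
    refine determined_mono ?_ this
    rintro _ ⟨y, hy, f, hf, rfl⟩
    change _ ≤ cross v (latticePt (y + f))
    rw [latticePt_add, cross_add_right]
    exact add_le_add hy (hmin f hf)
  · rintro ⟨c, hc⟩
    obtain ⟨f₀, hf₀⟩ := hF
    refine ⟨c - cross v (latticePt f₀), fun z => h.mem_determined_iff.2 fun f _ => ?_⟩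
    refine determined_mono ?_ (hc (z + f))
    refine fun y hy => ⟨y - f₀, ?_, f₀, hf₀, sub_add_cancel _ _⟩
    change _ ≤ cross v (latticePt (y - f₀))
    rw [latticePt_sub, cross_sub_right]
    exact sub_le_sub_right hy _

theorem IsExpansiveRay.of_sameRay {v w : ℝ × ℝ} (hv : v ≠ 0) (hw : w ≠ 0) (hvw : SameRay ℝ v w)
    (h : IsExpansiveRay X v) : IsExpansiveRay X w := by
  rw [isExpansiveRay_iff] at h ⊢
  obtain ⟨c, hc⟩ := h
  obtain ⟨s, t, hs, ht, hst⟩ := hvw.exists_pos hv hw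
  refine ⟨s * c / t, fun z => determined_mono (fun y hy => ?_) (hc z)⟩
  have h1 : c ≤ cross v (latticePt y) := hy
  change s * c / t ≤ cross w (latticePt y)
  rw [div_le_iff₀ ht, mul_comm _ t, ← cross_smul_left, ← hst, cross_smul_left]
  exact mul_le_mul_of_nonneg_left h1 hs.le

/-- A direction in which a coding polygon has a unique lowest vertex is expansive. -/
theorem IsCodingPolygon.isExpansiveRay (hP : IsCodingPolygon X P) {v p : ℝ × ℝ}
    (hp : p ∈ polygonVertices P) (hmin : ∀ x ∈ P, x ≠ p → cross v p < cross v x) :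
    IsExpansiveRay X v := by
  obtain ⟨p, rfl⟩ := hP.1.exists_latticePt_eq hp
  -- As `P` has finitely many lattice points, the lowest vertex is separated from the others by a
  -- gap `δ > 0`, and each round of coding gains a strip of width `δ`.
  obtain ⟨δ, hδ, hδmin⟩ : ∃ δ : ℝ, 0 < δ ∧ ∀ s ∈ latticePt ⁻¹' P \ {p},
      δ ≤ cross v (latticePt s - latticePt p) := by
    have hfin : (latticePt ⁻¹' P \ {p}).Finite := hP.1.finite_latticePts.subset Set.sdiff_subset
    rcases (latticePt ⁻¹' P \ {p}).eq_empty_or_nonempty with h | h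
    · exact ⟨1, one_pos, by simp [h]⟩
    · obtain ⟨s, hs, hsmin⟩ := Set.exists_min_image _
        (fun s => cross v (latticePt s - latticePt p)) hfin h
      refine ⟨_, ?_, hsmin⟩
      rw [cross_sub_right]
      exact sub_pos.2 (hmin _ hs.1 (latticePt_injective.ne hs.2))
  rw [isExpansiveRay_iff]
  refine ⟨0, fun z => ?_⟩
  have key : ∀ n : ℕ, ∀ z, -(n * δ) ≤ cross v (latticePt z) →
      z ∈ determined X {y | 0 ≤ cross v (latticePt y)} := by
    intro n
    induction n with
    | zero => exact fun z hz => subset_determined _ (by simpa using hz)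
    | succ n ih =>
      intro z hz
      have := add_mem_determined (T := {y | 0 ≤ cross v (latticePt y)}) (z - p)
        (hP.mem_determined hp) fun s hs => ih _ ?_
      · rwa [sub_add_cancel] at this
      · have h1 := hδmin s hs
        rw [cross_sub_right] at h1
        rw [latticePt_add, latticePt_sub, cross_add_right, cross_sub_right]
        push_cast at hz
        linarith
  obtain ⟨n, hn⟩ := exists_nat_ge (-cross v (latticePt z) / δ)
  rw [div_le_iff₀ hδ] at hn
  exact key n z (by linarith)

/-- Levels are integers and, `d` being primitive, all integers occur; a lattice translation
therefore moves any coding half plane into the levels above `0`. -/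
theorem mem_determined_of_isExpansiveRay {d : ℤ × ℤ} (hd : IsCoprime d.1 d.2)
    (h : IsExpansiveRay X (latticePt d)) : 0 ∈ determined X {z | 0 < latticeCross d z} := by
  obtain ⟨c, hc⟩ := isExpansiveRay_iff.1 h
  obtain ⟨z₁, hz₁⟩ := exists_latticeCross_eq_one hd
  have := add_mem_determined (T := {z | 0 < latticeCross d z}) ((1 - ⌊c⌋) • z₁)
    (hc (-((1 - ⌊c⌋) • z₁))) fun s hs => subset_determined _ ?_
  · rwa [add_neg_cancel] at this
  · have h1 : c ≤ cross (latticePt d) (latticePt s) := hs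
    rw [cross_latticePt] at h1
    have h2 : ⌊c⌋ ≤ latticeCross d s := Int.floor_le_iff.2 (by linarith)
    change 0 < latticeCross d _
    rw [latticeCross_add, latticeCross_smul, hz₁]
    linarith

/-- A set of at least `N` integers that is an interval contains `N` consecutive integers. -/
theorem exists_forall_mem_of_le_encard {I : Set ℤ} (hI : I.OrdConnected) {N : ℕ} (hN : 0 < N)
    (h : (N : ℕ∞) ≤ I.encard) : ∃ k₀ : ℤ, ∀ k, k₀ ≤ k → k < k₀ + N → k ∈ I := by
  obtain ⟨T, hTI, hT⟩ := Set.exists_subset_encard_eq h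
  have hTfin : T.Finite := Set.finite_of_encard_eq_coe hT
  have hTne : T.Nonempty := by
    rw [← Set.encard_pos, hT]
    exact_mod_cast hN
  obtain ⟨k₀, hk₀, hmin⟩ := Set.exists_min_image T id hTfin hTne
  obtain ⟨k₁, hk₁, hmax⟩ := Set.exists_max_image T id hTfin hTne
  refine ⟨k₀, fun k hk hk' => hI.out (hTI hk₀) (hTI hk₁) ⟨hk, ?_⟩⟩
  have hsub : T ⊆ Set.Icc k₀ k₁ := fun k hk => ⟨hmin k hk, hmax k hk⟩
  have hcard := Set.encard_le_encard hsub
  rw [hT, ← Finset.coe_Icc, Set.encard_coe_eq_coe_finsetCard, Int.card_Icc] at hcard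
  have hcard : N ≤ (k₁ + 1 - k₀).toNat := by exact_mod_cast hcard
  omega

/-- Long blocks in the line next to a half plane are closing, if the half plane is bounded by
an edge of a coding polygon of a recoding. -/
theorem IsRecodingVia.exists_closing_block {B : Type*} [TopologicalSpace B]
    {Y : Subshift B (ℤ × ℤ)} {F : Finset (ℤ × ℤ)} (h : IsRecodingVia X F Y) (hF : F.Nonempty)
    {S : Set (ℤ × ℤ)} {p d z₀ : ℤ × ℤ} {L : ℤ} (hS : EdgeCoding Y S p d L)
    (hz₀ : latticeCross d z₀ = -1) :
    ∃ N : ℕ, 0 < N ∧ ∀ (k₀ : ℤ) (T : Set (ℤ × ℤ)), (∀ z, 0 ≤ latticeCross d z → z ∈ T) →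
      (∀ k : ℤ, k₀ ≤ k → k < k₀ + N → z₀ + k • d ∈ T) →
      ∀ z, latticeCross d z = -1 → z ∈ determined X T := by
  obtain ⟨f₀, hf₀, hmin⟩ := F.exists_min_image (latticeCross d) hF
  have hJ : ∃ J : ℤ, 0 ≤ J ∧ ∀ f ∈ F, latticeCross d f = latticeCross d f₀ →
      ∃ i : ℤ, |i| ≤ J ∧ f = f₀ + i • d := by
    obtain ⟨a, b, hab⟩ := hS.coprime
    let φ : ℤ × ℤ → ℤ := fun f => |a * (f - f₀).1 + b * (f - f₀).2|
    obtain ⟨J, hJ⟩ := (F.finite_toSet.image φ).bddAbove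
    refine ⟨J, (abs_nonneg _).trans (hJ (Set.mem_image_of_mem φ hf₀)), fun f hf hff => ?_⟩
    obtain ⟨i, hi⟩ := exists_eq_smul_of_latticeCross_eq_zero (z := f - f₀) hS.coprime
      (by rw [latticeCross_sub, hff, sub_self])
    refine ⟨i, ?_, by rw [← hi]; abel⟩
    have h1 : φ f = |i| := by
      simp only [φ, hi, Prod.smul_fst, Prod.smul_snd, smul_eq_mul]
      congr 1
      linear_combination i * hab
    rw [← h1]
    exact hJ (Set.mem_image_of_mem φ hf)
  obtain ⟨J, hJ0, hJ⟩ := hJ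
  have hL := hS.pos
  -- The elements of `F` on its lowest level spread by at most `J` along `d` on either side of `f₀`.
  -- A block of `L + 2 * J` sites of `X` therefore contains the lowest parts of `L` consecutive
  -- windows of `Y`.
  refine ⟨(L + 2 * J).toNat, by omega, fun k₀ T hT hblock z hz => ?_⟩
  rw [Int.toNat_of_nonneg (by linarith)] at hblock
  -- The sites of `Y` whose color is known from `X` on `T`; the row argument for `Y` applies to this
  -- set.
  let C : Set (ℤ × ℤ) := {z | ∀ f ∈ F, z + f ∈ determined X T}
  have hC : determined Y C ⊆ C := fun z hz f hf =>
    determined_subset (by rintro _ ⟨y, hy, f, hf, rfl⟩; exact hy f hf)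
      (h.mem_determined_iff.1 hz f hf)
  have hrow := hS.row_subset (W := Set.univ) (r := -1 - latticeCross d f₀)
    (q := z₀ - f₀ + (k₀ + J) • d) hC (by simp) (by simp) (fun y _ s hs hpos hy _ f hf => ?_) ?_
    (fun j hj hjL => ⟨trivial, fun f hf => ?_⟩) (z - f₀) trivial
    (by rw [latticeCross_sub, hz])
  · have := hrow f₀ hf₀
    rwa [sub_add_cancel] at this
  · refine subset_determined _ (hT _ ?_)
    rw [latticeCross_add, latticeCross_add, hy]
    linarith [hmin f hf]
  · rw [latticeCross_add, latticeCross_sub, latticeCross_smul, latticeCross_self, hz₀]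
    ring
  · refine subset_determined _ ?_
    rcases (hmin f hf).eq_or_lt with heq | hlt
    · obtain ⟨i, hi, rfl⟩ := hJ f hf heq.symm
      have := abs_le.1 hi
      convert hblock (k₀ + J + j + i) (by linarith) (by linarith) using 1
      module
    · refine hT _ ?_
      rw [latticeCross_add, latticeCross_add, latticeCross_add, latticeCross_sub,
        latticeCross_smul, latticeCross_smul, latticeCross_self, hz₀]
      linarith

theorem IsRecodingVia.isClosingRay {B : Type*} [TopologicalSpace B]
    {Y : Subshift B (ℤ × ℤ)} {F : Finset (ℤ × ℤ)} (h : IsRecodingVia X F Y) (hF : F.Nonempty)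
    {S : Set (ℤ × ℤ)} {p d : ℤ × ℤ} {L : ℤ} (hS : EdgeCoding Y S p d L)
    (hne : IsNonexpansiveRay X (latticePt (L • d))) : IsClosingRay X (latticePt (L • d)) := by
  obtain ⟨z₁, hz₁⟩ := exists_latticeCross_eq_one hS.coprime
  have hd0 : d ≠ 0 := by
    rintro rfl
    simp [latticeCross] at hz₁
  have hLR : (0 : ℝ) < L := by exact_mod_cast hS.pos
  have hcross : ∀ z, cross (latticePt (L • d)) (latticePt z) = L * (latticeCross d z : ℝ) :=
    fun z => by rw [latticePt_smul, cross_smul_left, cross_latticePt]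
  have hz₀ : latticeCross d (-z₁) = -1 := by
    rw [← hz₁]
    simp only [latticeCross, Prod.fst_neg, Prod.snd_neg]
    ring
  obtain ⟨N, hN, hblock⟩ := h.exists_closing_block hF hS hz₀
  refine ⟨latticePt_ne_zero (smul_ne_zero hS.pos.ne' hd0), ⟨d, hd0, ?_⟩,
    fun hcodes => hne ⟨0, Or.inl hcodes⟩, -z₁, ⟨?_, fun z hz => ?_⟩, N, hN, ?_⟩
  · rw [hcross, latticeCross_self]
    simp
  · rw [hcross, hz₀]
    push_cast
    linarith
  · rw [hcross] at hz
    rw [hcross, hcross, hz₀]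
    have h1 : (latticeCross d z : ℝ) < 0 := neg_of_mul_neg_right hz hLR.le
    have h2 : latticeCross d z < 0 := by exact_mod_cast h1
    gcongr
    omega
  · intro a ha b hb hab
    -- In the coordinate `k` along the line the block is an interval of integers, so its cardinality
    -- yields `N` consecutive sites.
    let I : Set ℤ := {k | latticePt (-z₁ + k • d) ∈ segment ℝ a b}
    have hline : ∀ x ∈ segment ℝ a b, cross (latticePt (L • d)) x =
        cross (latticePt (L • d)) (latticePt (-z₁)) := by
      rintro _ ⟨s, t, -, -, hst, rfl⟩
      have ha' : cross (latticePt (L • d)) a = _ := ha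
      have hb' : cross (latticePt (L • d)) b = _ := hb
      rw [cross_add_right, cross_smul_right, cross_smul_right, ha', hb', ← add_mul, hst, one_mul]
    have hI : I.OrdConnected := by
      have hconv : Convex ℝ {t : ℝ | latticePt (-z₁) + t • latticePt d ∈ segment ℝ a b} := by
        exact ((convex_segment a b).translate_preimage_right (latticePt (-z₁))).linear_preimage
          (LinearMap.toSpanSingleton ℝ (ℝ × ℝ) (latticePt d))
      refine ⟨fun k hk k' hk' m hm => ?_⟩
      have hmem : ∀ k : ℤ, k ∈ I ↔
          (k : ℝ) ∈ {t : ℝ | latticePt (-z₁) + t • latticePt d ∈ segment ℝ a b} := fun k => by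
        simp only [I, Set.mem_ofPred_eq, latticePt_add, latticePt_smul]
      rw [hmem] at hk hk' ⊢
      exact hconv.ordConnected.out hk hk' ⟨by exact_mod_cast hm.1, by exact_mod_cast hm.2⟩
    have himage : {y : ℤ × ℤ | latticePt y ∈ segment ℝ a b} ⊆ (fun k : ℤ => -z₁ + k • d) '' I := by
      intro y hy
      have h1 := hline _ hy
      rw [hcross, hcross] at h1
      have h2 : latticeCross d y = latticeCross d (-z₁) := by
        exact_mod_cast mul_left_cancel₀ hLR.ne' h1
      obtain ⟨k, hk⟩ := exists_eq_smul_of_latticeCross_eq_zero (z := y - -z₁) hS.coprime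
        (by rw [latticeCross_sub, h2, sub_self])
      have hy' : -z₁ + k • d = y := by rw [← hk]; abel
      exact ⟨k, by rw [← hy'] at hy; exact hy, hy'⟩
    obtain ⟨k₀, hk₀⟩ := exists_forall_mem_of_le_encard hI hN
      (hab.trans ((Set.encard_le_encard himage).trans (Set.encard_image_le _ _)))
    rw [codes_iff]
    rintro z (hz | hz)
    · exact subset_determined _ (Or.inl hz)
    · refine hblock k₀ _ (fun y hy => Or.inl ?_) (fun k hk hk' => Or.inr (hk₀ k hk hk')) z ?_
      · change 0 ≤ cross (latticePt (L • d)) (latticePt y)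
        rw [hcross]
        exact mul_nonneg hLR.le (by exact_mod_cast hy)
      · have h1 : cross (latticePt (L • d)) (latticePt z) =
          cross (latticePt (L • d)) (latticePt (-z₁)) := hz
        rw [hcross, hcross] at h1
        rw [← hz₀]
        exact_mod_cast mul_left_cancel₀ hLR.ne' h1

end HalfPlanes

/-! ### Conclusion from minimality -/

theorem theorem5p14 {A : Type u} [Finite A] [TopologicalSpace A] [DiscreteTopology A]
    (X : SymbolicDynamics.FullShift.Subshift A (ℤ × ℤ)) (hX : IsPolygonal X)
    (P : Set (ℝ × ℝ)) (hP : IsRecodingPolygon X P)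
    (hmin : ∀ Q : Set (ℝ × ℝ), IsRecodingPolygon X Q → numSides P ≤ numSides Q) :
    (∀ e ∈ orientedEdges P, IsClosingRay X (e.2 - e.1)) ∧
    ∀ v : ℝ × ℝ, v ≠ 0 →
      (IsNonexpansiveRay X v ↔ ∃ e ∈ orientedEdges P, SameRay ℝ v (e.2 - e.1)) := by
  obtain ⟨B, _, _, _, Y, ⟨F, hY⟩, hPY⟩ := hP
  have hF := hY.nonempty hX.1
  have hYinf := hY.infinite hX.1
  have hedge : ∀ e ∈ orientedEdges P, IsNonexpansiveRay X (e.2 - e.1) ∧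
      IsClosingRay X (e.2 - e.1) := by
    rintro ⟨e₁, e₂⟩ he
    obtain ⟨p, d, L, rfl, rfl, hS⟩ := hPY.exists_edgeCoding he
    have hdir : latticePt (p + L • d) - latticePt p = latticePt (L • d) := by
      rw [← latticePt_sub, add_sub_cancel_left]
    simp only [hdir]
    have hne : IsNonexpansiveRay X (latticePt (L • d)) := by
      intro hexp
      have hexp' := (hY.isExpansiveRay_iff hF).2 hexp
      have hLR : (0 : ℝ) < L := by exact_mod_cast hS.pos
      have hLd : latticePt (L • d) ≠ 0 := by
        rw [← hdir]
        exact sub_ne_zero.2 (Ne.symm he.2.2.1)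
      have hd : latticePt d ≠ 0 := fun h => hLd (by rw [latticePt_smul, h, smul_zero])
      have := mem_determined_of_isExpansiveRay hS.coprime (hexp'.of_sameRay hLd hd (by
        rw [latticePt_smul]
        exact SameRay.sameRay_pos_smul_left _ hLR))
      obtain ⟨G, Q, hG, hQ, hcode, hlt⟩ := hPY.exists_fewer_sides hYinf he hS this
      exact (hmin Q (hY.isRecodingPolygon hG hQ hcode)).not_gt hlt
    exact ⟨hne, hY.isClosingRay hF hS hne⟩
  refine ⟨fun e he => (hedge e he).2, fun v hv => ⟨fun hne => ?_, ?_⟩⟩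
  · rcases exists_vertex_or_edge hPY.1.isCompact hPY.1.nonempty hv with
      ⟨p, hp, hlow⟩ | ⟨p, q, he, ⟨t, ht, hpq⟩, -⟩
    · exact (hne ((hY.isExpansiveRay_iff hF).1 (hPY.isExpansiveRay hp hlow))).elim
    · refine ⟨_, he, ?_⟩
      simp only [hpq]
      exact SameRay.sameRay_pos_smul_right _ ht
  · rintro ⟨e, he, hve⟩ hexp
    exact (hedge e he).1 (hexp.of_sameRay hv (sub_ne_zero.2 (Ne.symm he.2.2.1)) hve)
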